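/- Let $\mathcal E=\{y_{N+1}=F(x,y_0,\dots,y_N)\}\subset J^{N+1}(\mathbb R,\mathbb R)$ be a smooth scalar ODE of order $N+1$, with $F$ defined on an open subset of $J^N$; here $J^k=J^k(\mathbb R,\mathbb R)$ has the standard coordinates $(x,y_0,\dots,y_k)$. Let $\mathrm{Sol}$ be its manifold of solutions, that is, the (local) quotient of $\mathcal E$ by the foliation of (prolonged) solutions, and let $\mathrm{pr}\colon\mathcal E\to\mathrm{Sol}$ be the projection. For a solution $\Gamma$ let $\mathrm{Lin}^1_\Gamma$ be the curve in the projective space $\mathbb P(T_\Gamma\mathrm{Sol})$ that sends a point $\varepsilon\in\Gamma$ to the line $\mathrm{pr}_*(V^1_\varepsilon)$, where $V^1=\langle\partial/\partial y_N\rangle$ in the coordinates $(x,y_0,\dots,y_N)$ on $\mathcal E$. Assume that $\mathcal E$ is variational: there is a contact transformation of (open subsets of) $J^1$ whose prolongation to $J^{N+1}$ is defined on $\mathcal E$ and maps $\mathcal E$ onto the Euler--Lagrange equation $$\sum_{i=0}^{n}(-1)^i\frac{d^i}{dx^i}\frac{\partial f}{\partial y_i}=0,\qquad N+1=2n,$$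 given as an equation solved with respect to $y_{2n}$ over an open subset of $J^{2n-1}$, of a smooth Lagrangian $f(x,y,y',\dots,y^{(n)})\,dx$, defined over an open subset of $J^n$, with $\partial^2 f/\partial y_n^2\neq0$. Then for every solution $\Gamma$ the curve $\mathrm{Lin}^1_\Gamma$ is a (strongly regular) self-dual curve in $\mathbb P(T_\Gamma\mathrm{Sol})$. Explicitly: it has a smooth lift $e$ to $T_\Gamma\mathrm{Sol}\setminus\{0\}$ such that $e,e',\dots,e^{(N)}$ are linearly independent at each point, and there is a projective isomorphism $\mathbb P(T_\Gamma\mathrm{Sol})\to\mathbb P(T^*_\Gamma\mathrm{Sol})$ that maps each point of the curve to the annihilator of the osculating hyperplane $\langle e,e',\dots,e^{(N-1)}\rangle$ of the curve at that point. Moreover, there is a symplectic form on $T_\Gamma\mathrm{Sol}$ for which all osculating spaces $\langle e,\dots,e^{(n-1)}\rangle$ of half dimension $n=(N+1)/2$ are Lagrangian. -/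

import Mathlib

open scoped ContDiff

noncomputable section

/-! ### Jet spaces -/

/-- The jet space `J^k(ℝ, ℝ)` in its standard coordinates `(x, y₀, …, y_k)`. -/
abbrev Jet (k : ℕ) : Type := ℝ × (Fin (k + 1) → ℝ)

namespace Jet

/-- The canonical projection `π_{k,j} : J^k → J^j` for `j ≤ k`. -/
def trunc {j k : ℕ} (h : j ≤ k) (p : Jet k) : Jet j :=
  (p.1, fun i => p.2 (Fin.castLE (Nat.succ_le_succ h) i))

/-- The Cartan (contact) distribution of `J^k` at `p`: the common kernel of the contact forms
`θ_i = dy_i - y_{i+1} dx`, `0 ≤ i < k`. -/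
def cartan {k : ℕ} (p : Jet k) : Submodule ℝ (Jet k) where
  carrier := {v | ∀ i : Fin k, v.2 i.castSucc = p.2 i.succ * v.1}
  add_mem' := by
    intro a b ha hb i
    have h1 := ha i
    have h2 := hb i
    simp only [Prod.snd_add, Pi.add_apply, Prod.fst_add, h1, h2]
    ring
  zero_mem' := by intro i; simp
  smul_mem' := by
    intro c a ha i
    have h1 := ha i
    simp only [Prod.smul_snd, Pi.smul_apply, Prod.smul_fst, smul_eq_mul, h1]
    ring

/-- The `k`-jet at `x` of a function `y` of one real variable. -/
def ofFun (k : ℕ) (y : ℝ → ℝ) (x : ℝ) : Jet k := (x, fun i => iteratedDeriv i y x)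

/-- The vertical space `V^i` of `J^N`: the kernel of the differential of the projection
`J^N → J^{N-i}`, spanned by `∂/∂y_{N-i+1}, …, ∂/∂y_N`. -/
def vertical (N i : ℕ) : Submodule ℝ (Jet N) where
  carrier := {v | v.1 = 0 ∧ ∀ j : Fin (N + 1), (j : ℕ) + i ≤ N → v.2 j = 0}
  add_mem' := by
    rintro a b ⟨ha, ha'⟩ ⟨hb, hb'⟩
    exact ⟨by simp [ha, hb], fun j hj => by simp [ha' j hj, hb' j hj]⟩
  zero_mem' := ⟨rfl, fun _ _ => rfl⟩
  smul_mem' := by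
    rintro c a ⟨ha, ha'⟩
    exact ⟨by simp [ha], fun j hj => by simp [ha' j hj]⟩

/-- The partial derivative `∂g/∂y_i` of a function on `J^k`. -/
def partialY {k : ℕ} (g : Jet k → ℝ) (i : Fin (k + 1)) : Jet k → ℝ :=
  fun p => fderiv ℝ g p (0, Pi.single i 1)

/-- The total derivative `d/dx = ∂/∂x + ∑ y_{i+1} ∂/∂y_i` of a function on `J^k`, a function on
`J^{k+1}`. -/
def totalDeriv {k : ℕ} (g : Jet k → ℝ) : Jet (k + 1) → ℝ :=
  fun p => fderiv ℝ g (trunc (Nat.le_succ k) p) (1, fun i => p.2 i.succ)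

/-- The iterated total derivative `d^j/dx^j`. -/
def iterTotalDeriv {k : ℕ} (g : Jet k → ℝ) : (j : ℕ) → Jet (k + j) → ℝ
  | 0 => g
  | j + 1 => totalDeriv (iterTotalDeriv g j)

/-- The Euler–Lagrange expression `∑_{i=0}^n (-1)^i d^i/dx^i (∂f/∂y_i)` of the Lagrangian
`f(x, y, …, y^{(n)}) dx`, as a function on `J^M` for any `M ≥ 2n`. -/
def eulerLagrange {n : ℕ} (f : Jet n → ℝ) {M : ℕ} (h : 2 * n ≤ M) (p : Jet M) : ℝ :=
  ∑ i : Fin (n + 1), (-1 : ℝ) ^ (i : ℕ) *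
    iterTotalDeriv (partialY f i) i (trunc (by have := i.isLt; omega) p)

end Jet

/-! ### Scalar ordinary differential equations -/

/-- A smooth scalar ODE `y^{(N+1)} = F(x, y, …, y^{(N)})` of order `N + 1`, solved with respect to
the highest derivative; `F` is defined on an open subset of `J^N`. -/
structure ScalarODE (N : ℕ) where
  domain : Set (Jet N)
  isOpen_domain : IsOpen domain
  F : Jet N → ℝ
  smooth : ContDiffOn ℝ ∞ F domain

namespace ScalarODE

variable {N : ℕ}

/-- The ODE as a hypersurface `y_{N+1} = F(x, y₀, …, y_N)` of `J^{N+1}`. The projection to `J^N`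
identifies it with the open set `E.domain`, which is used as a coordinate domain for it. -/
def hypersurface (E : ScalarODE N) : Set (Jet (N + 1)) :=
  {p | Jet.trunc (Nat.le_succ N) p ∈ E.domain ∧
    p.2 (Fin.last (N + 1)) = E.F (Jet.trunc (Nat.le_succ N) p)}

/-- In the coordinates `(x, y₀, …, y_N)`, the vector field
`∂/∂x + ∑_{i<N} y_{i+1} ∂/∂y_i + F ∂/∂y_N` spanning the line distribution `S`. -/
def field (E : ScalarODE N) (p : Jet N) : Jet N :=
  (1, Fin.snoc (α := fun _ => ℝ) (fun i : Fin N => p.2 i.succ) (E.F p))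

/-- `y` is a (smooth) solution of the ODE on the open interval `I`. -/
structure IsSolution (E : ScalarODE N) (I : Set ℝ) (y : ℝ → ℝ) : Prop where
  isOpen : IsOpen I
  ordConnected : I.OrdConnected
  nonempty : I.Nonempty
  smooth : ContDiffOn ℝ ∞ y I
  mem_domain : ∀ x ∈ I, Jet.ofFun N y x ∈ E.domain
  eq : ∀ x ∈ I, iteratedDeriv (N + 1) y x = E.F (Jet.ofFun N y x)

/-- Two points of the equation lie on (the prolongation of) a common solution. -/
def OnCommonSolution (E : ScalarODE N) (p q : E.domain) : Prop :=
  ∃ (I : Set ℝ) (y : ℝ → ℝ), E.IsSolution I y ∧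
    (∃ x ∈ I, Jet.ofFun N y x = p) ∧ ∃ x ∈ I, Jet.ofFun N y x = q

/-- The space `Sol` of solutions: the quotient of the equation by the foliation of its solutions,
with the quotient topology. Its points are the leaves. -/
abbrev Sol (E : ScalarODE N) : Type := Quot E.OnCommonSolution

/-- The projection of the equation to `Sol`. -/
def toSol (E : ScalarODE N) (p : E.domain) : E.Sol := Quot.mk _ p

/-- The projection to `Sol` read in a chart `κ` of `Sol` and in the coordinates of `J^N`
(extended by zero outside the equation). -/
def projIn (E : ScalarODE N) (κ : OpenPartialHomeomorph E.Sol (Fin (N + 1) → ℝ)) :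
    Jet N → (Fin (N + 1) → ℝ) :=
  Function.extend (Subtype.val : E.domain → Jet N) (fun p => κ (E.toSol p)) 0

/-- `κ` is a chart of the quotient manifold `Sol`: it is a local homeomorphism of `Sol` to
`ℝ^{N+1}` in which the projection to `Sol` is smooth and its differential at every point `p`
has kernel `S_p` (so that, by dimension, it is a submersion). -/
def IsSmoothChart (E : ScalarODE N) (κ : OpenPartialHomeomorph E.Sol (Fin (N + 1) → ℝ)) : Prop :=
  ∀ p : E.domain, E.toSol p ∈ κ.source →
    ContDiffAt ℝ ∞ (E.projIn κ) p ∧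
    LinearMap.ker (fderiv ℝ (E.projIn κ) (p : Jet N) : Jet N →ₗ[ℝ] (Fin (N + 1) → ℝ)) =
      Submodule.span ℝ {E.field p}

/-- The linearization `Lin^i_Γ` of the distribution `V^i` along the solution `y`: the point
`(x, y(x), …, y^{(N)}(x))` of `Γ` is sent to the image of `V^i` under the differential of the
projection to `Sol`. It is a subspace of `T_Γ Sol`, which the chart `κ` identifies with
`ℝ^{N+1}`. -/
def lin (E : ScalarODE N) (κ : OpenPartialHomeomorph E.Sol (Fin (N + 1) → ℝ)) (i : ℕ)
    (y : ℝ → ℝ) (x : ℝ) : Submodule ℝ (Fin (N + 1) → ℝ) :=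
  (Jet.vertical N i).map
    (fderiv ℝ (E.projIn κ) (Jet.ofFun N y x) : Jet N →ₗ[ℝ] (Fin (N + 1) → ℝ))

/-! ### Contact equivalence and variational equations -/

/-- A (local) contact transformation of `J^k`: a diffeomorphism between open subsets of `J^k`
that preserves the Cartan distribution. -/
structure IsContactTransformation {k : ℕ} (Φ : OpenPartialHomeomorph (Jet k) (Jet k)) : Prop where
  smooth : ContDiffOn ℝ ∞ Φ Φ.source
  smooth_symm : ContDiffOn ℝ ∞ Φ.symm Φ.target
  map_cartan : ∀ p ∈ Φ.source, ∀ v ∈ Jet.cartan p, fderiv ℝ Φ p v ∈ Jet.cartan (Φ p)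

/-- `Φ'` prolongs `Φ` from `J^k` to `J^{k+1}`: it is a contact transformation that covers `Φ`. -/
structure IsProlongation {k : ℕ} (Φ : OpenPartialHomeomorph (Jet k) (Jet k))
    (Φ' : OpenPartialHomeomorph (Jet (k + 1)) (Jet (k + 1))) : Prop where
  contact : IsContactTransformation Φ'
  trunc_mem : ∀ p ∈ Φ'.source, Jet.trunc (Nat.le_succ k) p ∈ Φ.source
  trunc_map : ∀ p ∈ Φ'.source,
    Jet.trunc (Nat.le_succ k) (Φ' p) = Φ (Jet.trunc (Nat.le_succ k) p)

/-- Two equations of order `N + 1` are contact equivalent: there is a contact transformation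
`Φ 1` of `J^1` with successive prolongations `Φ 2, …, Φ (N + 1)` such that `Φ (N + 1)` is defined
on the first equation and maps it onto the second one. -/
def ContactEquivalent (E E' : ScalarODE N) : Prop :=
  ∃ Φ : (k : ℕ) → OpenPartialHomeomorph (Jet k) (Jet k),
    IsContactTransformation (Φ 1) ∧
    (∀ k, 1 ≤ k → k ≤ N → IsProlongation (Φ k) (Φ (k + 1))) ∧
    E.hypersurface ⊆ (Φ (N + 1)).source ∧
    Φ (N + 1) '' E.hypersurface = E'.hypersurface

/-- `E` is the Euler–Lagrange equation of a smooth Lagrangian `f(x, y, …, y^{(n)}) dx`, given on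
an open subset `D` of `J^n` and non-degenerate (`∂²f/∂y_n² ≠ 0`), where `2n` is the order of
`E`. -/
def IsEulerLagrange (E : ScalarODE N) : Prop :=
  ∃ (n : ℕ) (hn : N + 1 = 2 * n) (D : Set (Jet n)) (f : Jet n → ℝ),
    IsOpen D ∧ ContDiffOn ℝ ∞ f D ∧
    (∀ p ∈ D, Jet.partialY (Jet.partialY f (Fin.last n)) (Fin.last n) p ≠ 0) ∧
    (∀ p ∈ E.domain, Jet.trunc (by omega) p ∈ D) ∧
    ∀ p : Jet (N + 1), Jet.trunc (Nat.le_succ N) p ∈ E.domain →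
      (p ∈ E.hypersurface ↔ Jet.eulerLagrange f hn.ge p = 0)

/-- A variational ODE: one that is contact equivalent to the Euler–Lagrange equation of some
Lagrangian. -/
def IsVariational (E : ScalarODE N) : Prop :=
  ∃ E' : ScalarODE N, E'.IsEulerLagrange ∧ ContactEquivalent E E'

end ScalarODE

/-! ### Self-dual projective curves

A curve in the projective space `P(V)` is given by the lines `γ t ⊆ V` that are its points. -/

namespace ProjCurve

variable {V : Type*} [NormedAddCommGroup V] [NormedSpace ℝ V]

/-- `e` is a smooth lift to `V \ {0}` of the curve `γ` in `P(V)`, over `I`. -/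
structure IsLift (γ : ℝ → Submodule ℝ V) (I : Set ℝ) (e : ℝ → V) : Prop where
  smooth : ContDiffOn ℝ ∞ e I
  ne_zero : ∀ t ∈ I, e t ≠ 0
  span_eq : ∀ t ∈ I, γ t = Submodule.span ℝ {e t}

/-- The span of `e, e', …, e^{(k-1)}` at `t`: the osculating space of projective dimension `k - 1`
of the curve with lift `e`. It does not depend on the lift. -/
def osculating (e : ℝ → V) (k : ℕ) (t : ℝ) : Submodule ℝ V :=
  Submodule.span ℝ (Set.range fun j : Fin k => iteratedDeriv j e t)

/-- The curve `γ` in `P^N = P(ℝ^{N+1})`, parametrized by the open interval `I`, is strongly regular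
(`e, e', …, e^{(N)}` are linearly independent at all points, for a lift `e`) and self-dual: some
projective isomorphism of `P^N` to the dual space sends each point of the curve to the annihilator
of its osculating hyperplane `⟨e, …, e^{(N-1)}⟩` at that point. -/
def IsSelfDual {N : ℕ} (γ : ℝ → Submodule ℝ (Fin (N + 1) → ℝ)) (I : Set ℝ) : Prop :=
  ∃ e : ℝ → (Fin (N + 1) → ℝ), IsLift γ I e ∧
    (∀ t ∈ I, LinearIndependent ℝ fun j : Fin (N + 1) => iteratedDeriv j e t) ∧
    ∃ φ : (Fin (N + 1) → ℝ) ≃ₗ[ℝ] Module.Dual ℝ (Fin (N + 1) → ℝ), ∀ t ∈ I,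
      (γ t).map (φ : (Fin (N + 1) → ℝ) →ₗ[ℝ] Module.Dual ℝ (Fin (N + 1) → ℝ)) =
        (osculating e N t).dualAnnihilator

/-- There is a symplectic form `B` on `ℝ^{N+1}` for which all osculating spaces of half dimension
`(N + 1) / 2` of the curve `γ` are Lagrangian (equal to their `B`-orthogonal space). -/
def HasLagrangianOsculating {N : ℕ} (γ : ℝ → Submodule ℝ (Fin (N + 1) → ℝ)) (I : Set ℝ) : Prop :=
  ∃ e : ℝ → (Fin (N + 1) → ℝ), IsLift γ I e ∧
    ∃ B : LinearMap.BilinForm ℝ (Fin (N + 1) → ℝ), B.IsAlt ∧ B.Nondegenerate ∧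
      ∀ t ∈ I, B.orthogonal (osculating e ((N + 1) / 2) t) = osculating e ((N + 1) / 2) t

end ProjCurve

end

noncomputable section

/-! ### Self-duality from an alternating form -/

/-! Everything follows from one constant alternating form `B` on the tangent space of `Sol` at Γ.
Let `e` be the image of ∂/∂y_N under the differential of the projection to `Sol`. If `B(e, e^{(j)})
= 0` for all j < N while `B(e, ·) ≠ 0`, repeated differentiation gives `B(e^{(i)}, e^{(j)}) = 0` for
i + j < N and alternating nonzero values on i + j = N. Hence `B` is nondegenerate, `e ↦ B(e, ·)` is
the required projective isomorphism, and the osculating spaces of half dimension are isotropic of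
the right dimension (`isSelfDual_and_hasLagrangianOsculating`).

The derivatives of `e` are computed upstairs. The projection is constant along solutions, so
`e^{(j)}` is the image of a vertical field `frame j`, obtained from ∂/∂y_N by j applications of the
linearized-flow operator. This frame is triangular with ±1 on the antidiagonal. That gives strong
regularity, and it shows that `frame j` has no ∂/∂y_0 component for j < N. It therefore suffices
that `B` pairs `e` to zero with the images of vertical vectors having v_0 = 0.

For an Euler–Lagrange equation `B` is the linearization of ∑ dy_i ∧ dp_i with Ostrogradsky momenta
p_i, evaluated on solutions of the linearized equation. It is constant along Γ
(`hasDerivAt_symplecticForm`) and pairs ∂/∂y_{2n-1} with v to a nonzero multiple of v_0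
(`symplecticForm_top`). For N ≥ 2 a contact equivalence transports `B`: its prolongation preserves
the line of ∂/∂y_N, the direction of solutions and the hyperplane dy_0 = y_1 dx, which are the only
data the criterion uses. For N = 1 any area form works. -/

theorem ContDiffOn.iteratedDeriv_of_isOpen {V : Type*} [NormedAddCommGroup V] [NormedSpace ℝ V]
    {e : ℝ → V} {I : Set ℝ} (he : ContDiffOn ℝ ∞ e I) (hI : IsOpen I) (j : ℕ) :
    ContDiffOn ℝ ∞ (iteratedDeriv j e) I := by
  induction j with
  | zero => simpa using he
  | succ j ih => rw [iteratedDeriv_succ]; exact ih.deriv_of_isOpen hI (by simp)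

theorem iteratedDeriv_hasDerivAt_of_contDiffOn {V : Type*} [NormedAddCommGroup V] [NormedSpace ℝ V]
    {e : ℝ → V} {I : Set ℝ} (hI : IsOpen I) (he : ContDiffOn ℝ ∞ e I) (j : ℕ) {t : ℝ} (ht : t ∈ I) :
    HasDerivAt (iteratedDeriv j e) (iteratedDeriv (j + 1) e t) t := by
  rw [iteratedDeriv_succ]
  exact (((he.iteratedDeriv_of_isOpen hI j).contDiffAt (hI.mem_nhds ht)).differentiableAt
    (by simp)).hasDerivAt

namespace ProjCurve

theorem finrank_osculating {V : Type*} [NormedAddCommGroup V] [NormedSpace ℝ V] {N k : ℕ}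
    {e : ℝ → V} {t : ℝ} (h : LinearIndependent ℝ fun j : Fin (N + 1) => iteratedDeriv j e t)
    (hk : k ≤ N + 1) : Module.finrank ℝ (osculating e k t) = k := by
  have := finrank_span_eq_card (h.comp (Fin.castLE hk) (Fin.castLE_injective hk))
  exact this.trans (Fintype.card_fin k)

theorem hasDerivAt_bilin_iteratedDeriv {V : Type*} [NormedAddCommGroup V] [NormedSpace ℝ V]
    [FiniteDimensional ℝ V] {I : Set ℝ} (hI : IsOpen I) {e : ℝ → V}
    (he : ContDiffOn ℝ ∞ e I) (B : LinearMap.BilinForm ℝ V) (i j : ℕ) {t : ℝ} (ht : t ∈ I) :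
    HasDerivAt (fun s => B (iteratedDeriv i e s) (iteratedDeriv j e s))
      (B (iteratedDeriv (i + 1) e t) (iteratedDeriv j e t) +
        B (iteratedDeriv i e t) (iteratedDeriv (j + 1) e t)) t := by
  let C : V →L[ℝ] V →L[ℝ] ℝ :=
    LinearMap.toContinuousLinearMap (LinearMap.toContinuousLinearMap.toLinearMap ∘ₗ B)
  have h1 := C.hasFDerivAt.comp_hasDerivAt t (iteratedDeriv_hasDerivAt_of_contDiffOn hI he i ht)
  exact h1.clm_apply (iteratedDeriv_hasDerivAt_of_contDiffOn hI he j ht)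

theorem bilin_iteratedDeriv_add_eq_zero {V : Type*} [NormedAddCommGroup V] [NormedSpace ℝ V]
    [FiniteDimensional ℝ V] {I : Set ℝ} (hI : IsOpen I) {e : ℝ → V}
    (he : ContDiffOn ℝ ∞ e I) (B : LinearMap.BilinForm ℝ V) {i j : ℕ}
    (h : ∀ t ∈ I, B (iteratedDeriv i e t) (iteratedDeriv j e t) = 0) {t : ℝ} (ht : t ∈ I) :
    B (iteratedDeriv (i + 1) e t) (iteratedDeriv j e t) +
      B (iteratedDeriv i e t) (iteratedDeriv (j + 1) e t) = 0 := by
  refine (hasDerivAt_bilin_iteratedDeriv hI he B i j ht).unique ?_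
  refine (hasDerivAt_const t (0 : ℝ)).congr_of_eventuallyEq ?_
  filter_upwards [hI.mem_nhds ht] with s hs using h s hs

/-- If a bilinear form pairs `e` to zero with its first `N - 1` derivatives, then it pairs
`e^{(i)}` and `e^{(j)}` to zero for `i + j < N`. -/
theorem bilin_iteratedDeriv_eq_zero {V : Type*} [NormedAddCommGroup V] [NormedSpace ℝ V]
    [FiniteDimensional ℝ V] {N : ℕ} {I : Set ℝ} (hI : IsOpen I) {e : ℝ → V}
    (he : ContDiffOn ℝ ∞ e I) (B : LinearMap.BilinForm ℝ V)
    (hB : ∀ t ∈ I, ∀ j < N, B (e t) (iteratedDeriv j e t) = 0) (i : ℕ) :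
    ∀ j, i + j < N → ∀ t ∈ I, B (iteratedDeriv i e t) (iteratedDeriv j e t) = 0 := by
  induction i with
  | zero => intro j hj t ht; simpa using hB t ht j (by omega)
  | succ i ih =>
    intro j hj t ht
    have h := bilin_iteratedDeriv_add_eq_zero hI he B (ih j (by omega)) ht
    rwa [ih (j + 1) (by omega) t ht, add_zero] at h

/-- Differentiating the vanishing pairing on i + j = N - 1 shows that neighbouring entries on the
antidiagonal i + j = N are opposite. -/
theorem bilin_iteratedDeriv_antidiagonal {V : Type*} [NormedAddCommGroup V] [NormedSpace ℝ V]
    [FiniteDimensional ℝ V] {N : ℕ} {I : Set ℝ} (hI : IsOpen I) {e : ℝ → V}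
    (he : ContDiffOn ℝ ∞ e I) (B : LinearMap.BilinForm ℝ V)
    (hB : ∀ t ∈ I, ∀ j < N, B (e t) (iteratedDeriv j e t) = 0) (i : ℕ) :
    ∀ j, i + j = N → ∀ t ∈ I, B (iteratedDeriv i e t) (iteratedDeriv j e t) =
      (-1) ^ i * B (e t) (iteratedDeriv N e t) := by
  induction i with
  | zero => rintro j hj t -; simp [show j = N by omega]
  | succ i ih =>
    intro j hj t ht
    have h := bilin_iteratedDeriv_add_eq_zero hI he B
      (bilin_iteratedDeriv_eq_zero hI he B hB i j (by omega)) ht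
    rw [ih (j + 1) (by omega) t ht] at h
    rw [pow_succ]
    linarith

/-- In the basis of derivatives of `e` the Gram matrix vanishes above the antidiagonal and equals
±B(e, e^{(N)}) on it. This number is nonzero, since otherwise `e` would be orthogonal to the whole
basis. -/
theorem nondegenerate_of_iteratedDeriv {N : ℕ} {I : Set ℝ} (hI : IsOpen I)
    {e : ℝ → (Fin (N + 1) → ℝ)} (he : ContDiffOn ℝ ∞ e I) {t : ℝ} (ht : t ∈ I)
    (hli : LinearIndependent ℝ fun j : Fin (N + 1) => iteratedDeriv j e t)
    {B : LinearMap.BilinForm ℝ (Fin (N + 1) → ℝ)} (hBa : B.IsAlt)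
    (hB : ∀ t ∈ I, ∀ j < N, B (e t) (iteratedDeriv j e t) = 0)
    (hne : ∃ w, B (e t) w ≠ 0) : B.Nondegenerate := by
  have hspan : Submodule.span ℝ (Set.range fun j : Fin (N + 1) => iteratedDeriv j e t) = ⊤ :=
    hli.span_eq_top_of_card_eq_finrank' (by simp)
  have hN : B (e t) (iteratedDeriv N e t) ≠ 0 := by
    intro h0
    obtain ⟨w, hw⟩ := hne
    refine hw ?_
    have hle : (⊤ : Submodule ℝ (Fin (N + 1) → ℝ)) ≤ LinearMap.ker (B (e t)) := by
      rw [← hspan, Submodule.span_le]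
      rintro _ ⟨j, rfl⟩
      rcases (Nat.lt_succ_iff.1 j.isLt).lt_or_eq with hj | hj
      · exact hB t ht j hj
      · simpa [hj] using h0
    exact hle (Submodule.mem_top (x := w))
  refine (hBa.isRefl.nondegenerate_iff_separatingLeft).2 fun w hw => ?_
  have hwm : w ∈ Submodule.span ℝ (Set.range fun j : Fin (N + 1) => iteratedDeriv j e t) :=
    hspan ▸ Submodule.mem_top
  obtain ⟨c, rfl⟩ := (Submodule.mem_span_range_iff_exists_fun ℝ).1 hwm
  -- Reversing the columns turns the antidiagonal into the diagonal, so the Gram matrix becomes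
  -- lower triangular.
  let G : Matrix (Fin (N + 1)) (Fin (N + 1)) ℝ :=
    Matrix.of fun i j => B (iteratedDeriv i e t) (iteratedDeriv (Fin.rev j) e t)
  have hG : G.det ≠ 0 := by
    rw [Matrix.det_of_isLowerTriangular G, Finset.prod_ne_zero_iff]
    · intro i _
      have := bilin_iteratedDeriv_antidiagonal hI he B hB i (Fin.rev i)
        (by rw [Fin.val_rev]; omega) t ht
      simp only [G, Matrix.of_apply, this]
      exact mul_ne_zero (pow_ne_zero _ (by norm_num)) hN
    · intro i j hij
      have hij' : i < j := hij
      refine bilin_iteratedDeriv_eq_zero hI he B hB i _ ?_ t ht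
      rw [Fin.val_rev]
      have := Fin.lt_def.1 hij'
      omega
  have hc : c = 0 := by
    refine Matrix.eq_zero_of_vecMul_eq_zero hG ?_
    ext j
    have := hw (iteratedDeriv (Fin.rev j) e t)
    simpa [Matrix.vecMul, dotProduct, G] using this
  simp [hc]

/-- A strongly regular curve whose points are orthogonal to its osculating hyperplanes, for an
alternating form that has no point of the curve in its kernel, is self-dual with Lagrangian
osculating spaces of half dimension. -/
theorem isSelfDual_and_hasLagrangianOsculating {N n : ℕ} (hn : N + 1 = 2 * n) {I : Set ℝ}
    (hI : IsOpen I) (hI0 : I.Nonempty) {γ : ℝ → Submodule ℝ (Fin (N + 1) → ℝ)}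
    {e : ℝ → (Fin (N + 1) → ℝ)} (he : IsLift γ I e)
    (hli : ∀ t ∈ I, LinearIndependent ℝ fun j : Fin (N + 1) => iteratedDeriv j e t)
    {B : LinearMap.BilinForm ℝ (Fin (N + 1) → ℝ)} (hBa : B.IsAlt)
    (hB : ∀ t ∈ I, ∀ j < N, B (e t) (iteratedDeriv j e t) = 0)
    (hne : ∀ t ∈ I, ∃ w, B (e t) w ≠ 0) :
    IsSelfDual γ I ∧ HasLagrangianOsculating γ I := by
  obtain ⟨t₀, ht₀⟩ := hI0
  have hnd := nondegenerate_of_iteratedDeriv hI he.smooth ht₀ (hli t₀ ht₀) hBa hB (hne t₀ ht₀)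
  refine ⟨⟨e, he, hli, B.toDual hnd, fun t ht => ?_⟩, e, he, B, hBa, hnd, fun t ht => ?_⟩
  · refine Submodule.eq_of_le_of_finrank_eq ?_ ?_
    · rw [he.span_eq t ht, Submodule.map_span, Set.image_singleton, Submodule.span_le,
        Set.singleton_subset_iff, SetLike.mem_coe, Submodule.mem_dualAnnihilator]
      intro w hw
      have hle : osculating e N t ≤ LinearMap.ker (B (e t)) := by
        rw [osculating, Submodule.span_le]
        rintro _ ⟨j, rfl⟩
        exact hB t ht j j.isLt
      exact hle hw
    · have h1 := Subspace.finrank_add_finrank_dualAnnihilator_eq (osculating e N t)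
      rw [finrank_osculating (hli t ht) (Nat.le_succ N), Module.finrank_fin_fun] at h1
      rw [LinearEquiv.finrank_map_eq, he.span_eq t ht, finrank_span_singleton (he.ne_zero t ht)]
      omega
  · symm
    refine Submodule.eq_of_le_of_finrank_eq ?_ ?_
    · intro v hv w hw
      have h2 : ∀ i : Fin ((N + 1) / 2), ∀ v ∈ osculating e ((N + 1) / 2) t,
          B (iteratedDeriv i e t) v = 0 := by
        intro i v hv
        have hle : osculating e ((N + 1) / 2) t ≤ LinearMap.ker (B (iteratedDeriv i e t)) := by
          rw [osculating, Submodule.span_le]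
          rintro _ ⟨j, rfl⟩
          -- Here i, j ≤ n - 1, so i + j ≤ 2n - 2 = N - 1.
          exact bilin_iteratedDeriv_eq_zero hI he.smooth B hB i j (by omega) t ht
        exact hle hv
      have hle : osculating e ((N + 1) / 2) t ≤ LinearMap.ker (B.flip v) := by
        rw [osculating, Submodule.span_le]
        rintro _ ⟨j, rfl⟩
        exact h2 j v hv
      exact hle hw
    · rw [LinearMap.BilinForm.finrank_orthogonal hnd, finrank_osculating (hli t ht) (by omega),
        Module.finrank_fin_fun]
      omega

end ProjCurve

/-! ### The linearized equation and the derivatives of the linearization curve -/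

theorem hasFDerivAt_fderiv {V W : Type*} [NormedAddCommGroup V] [NormedSpace ℝ V]
    [NormedAddCommGroup W] [NormedSpace ℝ W] {g : V → W} {p : V} (hg : ContDiffAt ℝ ∞ g p) :
    HasFDerivAt (fderiv ℝ g) (fderiv ℝ (fderiv ℝ g) p) p :=
  ((hg.fderiv_right (m := ∞) (by simp)).differentiableAt (by simp)).hasFDerivAt

/-- The derivative of `dg (u)` along a curve `c`. -/
theorem hasDerivAt_fderiv_curve {V W : Type*} [NormedAddCommGroup V] [NormedSpace ℝ V]
    [NormedAddCommGroup W] [NormedSpace ℝ W] {g : V → W} {c u : ℝ → V} {c' u' : V} {x : ℝ}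
    (hg : ContDiffAt ℝ ∞ g (c x)) (hc : HasDerivAt c c' x) (hu : HasDerivAt u u' x) :
    HasDerivAt (fun z => fderiv ℝ g (c z) (u z))
      (fderiv ℝ (fderiv ℝ g) (c x) (u x) c' + fderiv ℝ g (c x) u') x := by
  -- The product rule differentiates in the direction c' first; symmetry of the second derivative
  -- puts `u` in the first slot.
  have hsymm : IsSymmSndFDerivAt ℝ g (c x) := hg.isSymmSndFDerivAt
    (by rw [minSmoothness_of_isRCLikeNormedField]; exact WithTop.coe_le_coe.2 (le_top : (2 : ℕ∞) ≤ ⊤))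
  rw [hsymm.eq]
  exact ((hasFDerivAt_fderiv hg).comp_hasDerivAt x hc).clm_apply hu

namespace ScalarODE

variable {N : ℕ}

theorem contDiffOn_field (E : ScalarODE N) : ContDiffOn ℝ ∞ E.field E.domain := by
  refine contDiffOn_const.prodMk (contDiffOn_pi.2 fun i => ?_)
  induction i using Fin.lastCases with
  | last => simpa using E.smooth
  | cast i =>
    simp only [Fin.snoc_castSucc]
    fun_prop

theorem differentiableAt_field (E : ScalarODE N) {p : Jet N} (hp : p ∈ E.domain) :
    DifferentiableAt ℝ E.field p :=
  (E.contDiffOn_field.contDiffAt (E.isOpen_domain.mem_nhds hp)).differentiableAt (by simp)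

theorem fderiv_field_fst (E : ScalarODE N) {p : Jet N} (hp : p ∈ E.domain) (v : Jet N) :
    (fderiv ℝ E.field p v).1 = 0 := by
  have h := ((ContinuousLinearMap.fst ℝ ℝ (Fin (N + 1) → ℝ)).hasFDerivAt.comp p
    (E.differentiableAt_field hp).hasFDerivAt).unique (hasFDerivAt_const (1 : ℝ) p)
  exact DFunLike.congr_fun h v

theorem fderiv_field_snd (E : ScalarODE N) {p : Jet N} (hp : p ∈ E.domain) (v : Jet N)
    (i : Fin (N + 1)) :
    (fderiv ℝ E.field p v).2 i = fderiv ℝ (fun q => (E.field q).2 i) p v := by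
  have h := (((ContinuousLinearMap.proj i).comp
    (ContinuousLinearMap.snd ℝ ℝ (Fin (N + 1) → ℝ))).hasFDerivAt.comp p
    (E.differentiableAt_field hp).hasFDerivAt).fderiv
  exact (DFunLike.congr_fun h v).symm

theorem fderiv_field_castSucc (E : ScalarODE N) {p : Jet N} (hp : p ∈ E.domain) (v : Jet N)
    (i : Fin N) : (fderiv ℝ E.field p v).2 i.castSucc = v.2 i.succ := by
  rw [E.fderiv_field_snd hp]
  have h : (fun q => (E.field q).2 i.castSucc) = ((ContinuousLinearMap.proj i.succ).comp
      (ContinuousLinearMap.snd ℝ ℝ (Fin (N + 1) → ℝ)) : Jet N →L[ℝ] ℝ) := by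
    ext q; simp [field]
  rw [h, ContinuousLinearMap.fderiv]
  rfl

theorem fderiv_field_last (E : ScalarODE N) {p : Jet N} (hp : p ∈ E.domain) (v : Jet N) :
    (fderiv ℝ E.field p v).2 (Fin.last N) = fderiv ℝ E.F p v := by
  rw [E.fderiv_field_snd hp]
  simp [field]

/-- Along a (reparametrized) integral curve of the equation, a first-integral map `π` turns the
linearized flow into the ordinary derivative. -/
theorem hasDerivAt_fderiv_apply (E : ScalarODE N) {W : Type*} [NormedAddCommGroup W]
    [NormedSpace ℝ W] {π : Jet N → W} {U : Set (Jet N)} (hU : IsOpen U) (hUE : U ⊆ E.domain)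
    (hπ : ContDiffOn ℝ ∞ π U) (hker : ∀ p ∈ U, fderiv ℝ π p (E.field p) = 0)
    {c a : ℝ → Jet N} {r x : ℝ} {a' : Jet N} (hcx : c x ∈ U)
    (hc : HasDerivAt c (r • E.field (c x)) x) (ha : HasDerivAt a a' x) :
    HasDerivAt (fun s => fderiv ℝ π (c s) (a s))
      (fderiv ℝ π (c x) (a' - r • fderiv ℝ E.field (c x) (a x))) x := by
  have hπx : ContDiffAt ℝ ∞ π (c x) := hπ.contDiffAt (hU.mem_nhds hcx)
  -- Differentiating dπ(field) = 0 in the direction a trades the second derivative of π on (a,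
  -- field) for -dπ applied to the linearized field.
  have h0 := ((hasFDerivAt_fderiv hπx).clm_apply (E.differentiableAt_field (hUE hcx)).hasFDerivAt).unique
    ((hasFDerivAt_const (0 : W) (c x)).congr_of_eventuallyEq (by
      filter_upwards [hU.mem_nhds hcx] with q hq using hker q hq))
  have h1 := DFunLike.congr_fun h0 (a x)
  simp at h1
  have h2 := hasDerivAt_fderiv_curve hπx hc ha
  refine h2.congr_deriv ?_
  simp only [map_sub, map_smul]
  rw [eq_neg_of_add_eq_zero_right h1]
  simp [add_comm, sub_eq_add_neg]

/-- The vectors that represent the derivatives of the linearization curve `Lin^1`. -/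
def frame (E : ScalarODE N) (y : ℝ → ℝ) : ℕ → ℝ → Jet N
  | 0 => fun _ => (0, Pi.single (Fin.last N) 1)
  | j + 1 => fun x => deriv (E.frame y j) x -
      fderiv ℝ E.field (Jet.ofFun N y x) (E.frame y j x)

section Solution

variable {E : ScalarODE N} {I : Set ℝ} {y : ℝ → ℝ}

theorem IsSolution.contDiffOn_ofFun (hy : E.IsSolution I y) (k : ℕ) :
    ContDiffOn ℝ ∞ (Jet.ofFun k y) I :=
  contDiffOn_id.prodMk (contDiffOn_pi.2 fun i => hy.smooth.iteratedDeriv_of_isOpen hy.isOpen i)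

theorem IsSolution.hasDerivAt_ofFun (hy : E.IsSolution I y) {x : ℝ} (hx : x ∈ I) :
    HasDerivAt (Jet.ofFun N y) (E.field (Jet.ofFun N y x)) x := by
  refine (hasDerivAt_id x).prodMk (hasDerivAt_pi.2 fun i => ?_)
  have h := iteratedDeriv_hasDerivAt_of_contDiffOn hy.isOpen hy.smooth i hx
  induction i using Fin.lastCases with
  | last =>
    simp only [Fin.snoc_last]
    rw [← hy.eq x hx]
    exact h
  | cast i =>
    simp only [Fin.snoc_castSucc]
    exact h

theorem IsSolution.contDiffOn_frame (hy : E.IsSolution I y) (j : ℕ) :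
    ContDiffOn ℝ ∞ (E.frame y j) I := by
  induction j with
  | zero => exact contDiffOn_const
  | succ j ih =>
    have h : ContDiffOn ℝ ∞ (fderiv ℝ E.field) E.domain :=
      E.contDiffOn_field.fderiv_of_isOpen E.isOpen_domain (by simp)
    exact (ih.deriv_of_isOpen hy.isOpen (by simp)).sub
      ((h.comp (hy.contDiffOn_ofFun N) hy.mem_domain).clm_apply ih)

theorem IsSolution.hasDerivAt_frame (hy : E.IsSolution I y) (j : ℕ) {x : ℝ} (hx : x ∈ I) :
    HasDerivAt (E.frame y j) (deriv (E.frame y j) x) x :=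
  (((hy.contDiffOn_frame j).contDiffAt (hy.isOpen.mem_nhds hx)).differentiableAt
    (by simp)).hasDerivAt

theorem IsSolution.frame_fst (hy : E.IsSolution I y) (j : ℕ) :
    ∀ x ∈ I, (E.frame y j x).1 = 0 := by
  induction j with
  | zero => intro x _; rfl
  | succ j ih =>
    intro x hx
    have h := ((ContinuousLinearMap.fst ℝ ℝ (Fin (N + 1) → ℝ)).hasFDerivAt.comp_hasDerivAt x
      (hy.hasDerivAt_frame j hx)).unique
      ((hasDerivAt_const x (0 : ℝ)).congr_of_eventuallyEq (by
        filter_upwards [hy.isOpen.mem_nhds hx] with s hs using ih s hs))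
    simp only [ContinuousLinearMap.coe_fst'] at h
    simp only [frame, Prod.fst_sub]
    rw [h, E.fderiv_field_fst (hy.mem_domain x hx), sub_zero]

/-- The linearized field shifts coordinates down by one, so each step of the recursion moves the
leading entry from ∂/∂y_{i+1} to ∂/∂y_i and changes its sign. The derivative term does not
interfere, because the entries concerned are identically zero one step earlier. -/
theorem IsSolution.frame_snd_aux (hy : E.IsSolution I y) (j : ℕ) (hj : j ≤ N) :
    ∀ i : Fin (N + 1), (i : ℕ) + j ≤ N → ∀ x ∈ I,
      (E.frame y j x).2 i = if (i : ℕ) + j = N then (-1) ^ j else 0 := by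
  induction j with
  | zero =>
    intro i hi x hx
    by_cases h : i = Fin.last N
    · subst h; simp [frame]
    · have h' : (i : ℕ) ≠ N := fun h' => h (Fin.ext h')
      simp [frame, h, h']
  | succ j ih =>
    intro i hi x hx
    obtain ⟨i, rfl⟩ : ∃ i' : Fin N, i = i'.castSucc :=
      ⟨⟨i, by omega⟩, rfl⟩
    rw [Fin.val_castSucc] at *
    have h := (((ContinuousLinearMap.proj i.castSucc).comp
      (ContinuousLinearMap.snd ℝ ℝ (Fin (N + 1) → ℝ))).hasFDerivAt.comp_hasDerivAt x
      (hy.hasDerivAt_frame j hx)).unique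
      ((hasDerivAt_const x (0 : ℝ)).congr_of_eventuallyEq (by
        filter_upwards [hy.isOpen.mem_nhds hx] with s hs
        change (E.frame y j s).2 i.castSucc = 0
        rw [ih (by omega) i.castSucc (by rw [Fin.val_castSucc]; omega) s hs, if_neg]
        rw [Fin.val_castSucc]; omega))
    simp only [ContinuousLinearMap.comp_apply, ContinuousLinearMap.coe_snd',
      ContinuousLinearMap.proj_apply] at h
    simp only [frame, Prod.snd_sub, Pi.sub_apply]
    rw [h, E.fderiv_field_castSucc (hy.mem_domain x hx),
      ih (by omega) i.succ (by rw [Fin.val_succ]; omega) x hx, Fin.val_succ]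
    have h2 : (i : ℕ) + (j + 1) = i + 1 + j := by omega
    rw [h2]
    split_ifs <;> ring

theorem IsSolution.iteratedDeriv_fderiv (hy : E.IsSolution I y) {W : Type*}
    [NormedAddCommGroup W] [NormedSpace ℝ W] {π : Jet N → W} {U : Set (Jet N)} (hU : IsOpen U)
    (hUE : U ⊆ E.domain) (hπ : ContDiffOn ℝ ∞ π U) (hker : ∀ p ∈ U, fderiv ℝ π p (E.field p) = 0)
    (hyU : ∀ x ∈ I, Jet.ofFun N y x ∈ U) (j : ℕ) :
    ∀ x ∈ I, iteratedDeriv j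
        (fun s => fderiv ℝ π (Jet.ofFun N y s) (0, Pi.single (Fin.last N) 1)) x =
      fderiv ℝ π (Jet.ofFun N y x) (E.frame y j x) := by
  induction j with
  | zero => intro x _; simp [frame]
  | succ j ih =>
    intro x hx
    rw [iteratedDeriv_succ]
    have h := E.hasDerivAt_fderiv_apply (c := Jet.ofFun N y) (r := 1) hU hUE hπ hker (hyU x hx)
      (by simpa using hy.hasDerivAt_ofFun hx) (hy.hasDerivAt_frame j hx)
    rw [one_smul] at h
    refine HasDerivAt.deriv (h.congr_of_eventuallyEq ?_)
    filter_upwards [hy.isOpen.mem_nhds hx] with s hs using ih s hs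

theorem IsSolution.linearIndependent_frame (hy : E.IsSolution I y) {x : ℝ} (hx : x ∈ I) :
    LinearIndependent ℝ fun j : Fin (N + 1) => (E.frame y j x).2 := by
  let G : Matrix (Fin (N + 1)) (Fin (N + 1)) ℝ :=
    Matrix.of fun j i => (E.frame y j x).2 (Fin.rev i)
  have hG : G.det ≠ 0 := by
    rw [Matrix.det_of_isLowerTriangular G, Finset.prod_ne_zero_iff]
    · intro i _
      have := i.isLt
      simp only [G, Matrix.of_apply]
      rw [hy.frame_snd_aux i (by omega) _ (by rw [Fin.val_rev]; omega) x hx,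
        if_pos (by rw [Fin.val_rev]; omega)]
      exact pow_ne_zero _ (by norm_num)
    · intro j i hji
      have hji' : (j : ℕ) < i := hji
      have := i.isLt
      simp only [G, Matrix.of_apply]
      rw [hy.frame_snd_aux j (by omega) _ (by rw [Fin.val_rev]; omega) x hx,
        if_neg (by rw [Fin.val_rev]; omega)]
  rw [Fintype.linearIndependent_iff]
  intro g hg
  have h : g = 0 := by
    refine Matrix.eq_zero_of_vecMul_eq_zero hG ?_
    ext i
    have := congr_fun hg (Fin.rev i)
    simpa [Matrix.vecMul, dotProduct, G] using this
  exact fun i => congr_fun h i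

end Solution

end ScalarODE

/-! ### Linearization of total derivatives -/

namespace Jet

/-- The jet with independent variable `t` and the coordinates `s 0, …, s m`. -/
def ofSeq (m : ℕ) (t : ℝ) (s : ℕ → ℝ) : Jet m := (t, fun i => s i)

/-- The vertical tangent vector with the coordinates `s 0, …, s m`. -/
def vecOfSeq (m : ℕ) : (ℕ → ℝ) →ₗ[ℝ] Jet m where
  toFun := ofSeq m 0
  map_add' s s' := by ext <;> simp [ofSeq]
  map_smul' c s := by ext <;> simp [ofSeq]

/-- The projection of jet spaces as a continuous linear map. -/
def truncL {j k : ℕ} (h : j ≤ k) : Jet k →L[ℝ] Jet j :=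
  (ContinuousLinearMap.fst ℝ ℝ (Fin (k + 1) → ℝ)).prod
    (ContinuousLinearMap.pi fun i => (ContinuousLinearMap.proj (Fin.castLE (Nat.succ_le_succ h) i)).comp
      (ContinuousLinearMap.snd ℝ ℝ (Fin (k + 1) → ℝ)))

theorem coe_truncL {j k : ℕ} (h : j ≤ k) : ⇑(truncL h) = trunc h := rfl

/-- The linear map `(x, y₀, …, y_{k+1}) ↦ (0, y₁, …, y_{k+1})`. -/
def shiftL (k : ℕ) : Jet (k + 1) →L[ℝ] Jet k :=
  (0 : Jet (k + 1) →L[ℝ] ℝ).prod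
    (ContinuousLinearMap.pi fun i => (ContinuousLinearMap.proj i.succ).comp
      (ContinuousLinearMap.snd ℝ ℝ (Fin (k + 1 + 1) → ℝ)))

theorem totalDeriv_eq {k : ℕ} (g : Jet k → ℝ) : totalDeriv g =
    fun p => fderiv ℝ g (truncL (Nat.le_succ k) p) ((1, 0) + shiftL k p) := by
  ext p
  simp only [totalDeriv, coe_truncL]
  congr 1
  ext i <;> simp [shiftL]

theorem isOpen_preimage_trunc {j k : ℕ} (h : j ≤ k) {D : Set (Jet j)} (hD : IsOpen D) :
    IsOpen {p : Jet k | trunc h p ∈ D} :=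
  hD.preimage (truncL h).continuous

theorem contDiffOn_totalDeriv {k : ℕ} {g : Jet k → ℝ} {D : Set (Jet k)} (hD : IsOpen D)
    (hg : ContDiffOn ℝ ∞ g D) :
    ContDiffOn ℝ ∞ (totalDeriv g) {p | trunc (Nat.le_succ k) p ∈ D} := by
  rw [totalDeriv_eq]
  have h : ContDiffOn ℝ ∞ (fun p => fderiv ℝ g (truncL (Nat.le_succ k) p))
      {p | trunc (Nat.le_succ k) p ∈ D} :=
    (hg.fderiv_of_isOpen hD (m := ∞) (by simp)).comp (truncL _).contDiff.contDiffOn fun p hp => hp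
  exact h.clm_apply (contDiff_const.add (shiftL k).contDiff).contDiffOn

theorem contDiffOn_iterTotalDeriv {n : ℕ} {g : Jet n → ℝ} {D : Set (Jet n)} (hD : IsOpen D)
    (hg : ContDiffOn ℝ ∞ g D) (k : ℕ) :
    ContDiffOn ℝ ∞ (iterTotalDeriv g k) {p | trunc (Nat.le_add_right n k) p ∈ D} := by
  induction k with
  | zero => exact hg
  | succ k ih => exact contDiffOn_totalDeriv (isOpen_preimage_trunc _ hD) ih

theorem contDiffAt_iterTotalDeriv {n : ℕ} {g : Jet n → ℝ} {D : Set (Jet n)} (hD : IsOpen D)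
    (hg : ContDiffOn ℝ ∞ g D) (k : ℕ) {t : ℝ} {s : ℕ → ℝ} (hs : ofSeq n t s ∈ D) :
    ContDiffAt ℝ ∞ (iterTotalDeriv g k) (ofSeq (n + k) t s) :=
  (contDiffOn_iterTotalDeriv hD hg k).contDiffAt
    ((isOpen_preimage_trunc _ hD).mem_nhds hs)

theorem fderiv_totalDeriv {k : ℕ} {g : Jet k → ℝ} {p : Jet (k + 1)}
    (hg : ContDiffAt ℝ ∞ g (truncL (Nat.le_succ k) p)) (v : Jet (k + 1)) :
    fderiv ℝ (totalDeriv g) p v =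
      fderiv ℝ (fderiv ℝ g) (truncL (Nat.le_succ k) p) (truncL (Nat.le_succ k) v)
        ((1, 0) + shiftL k p) + fderiv ℝ g (truncL (Nat.le_succ k) p) (shiftL k v) := by
  have h : HasFDerivAt (fun q => fderiv ℝ g (truncL (Nat.le_succ k) q) ((1, 0) + shiftL k q)) _ p :=
    ((hasFDerivAt_fderiv hg).comp p (truncL _).hasFDerivAt).clm_apply
      ((shiftL k).hasFDerivAt.const_add (1, 0))
  rw [totalDeriv_eq, h.fderiv]
  simp [add_comm]

theorem shiftL_ofSeq (m : ℕ) (t : ℝ) (s : ℕ → ℝ) :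
    shiftL m (ofSeq (m + 1) t s) = ofSeq m 0 fun i => s (i + 1) := by
  ext i <;> simp [shiftL, ofSeq]

theorem truncL_ofSeq {j k : ℕ} (h : j ≤ k) (t : ℝ) (s : ℕ → ℝ) :
    truncL h (ofSeq k t s) = ofSeq j t s := rfl

theorem hasDerivAt_ofSeq {m : ℕ} {t : ℝ → ℝ} {s : ℝ → ℕ → ℝ} {t' : ℝ} {s' : ℕ → ℝ} {x : ℝ}
    (ht : HasDerivAt t t' x) (hs : ∀ i ≤ m, HasDerivAt (fun z => s z i) (s' i) x) :
    HasDerivAt (fun z => ofSeq m (t z) (s z)) (ofSeq m t' s') x :=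
  ht.prodMk (hasDerivAt_pi.2 fun i => hs i (Nat.lt_succ_iff.1 i.isLt))

theorem hasDerivAt_vecOfSeq {m : ℕ} {s : ℝ → ℕ → ℝ} {s' : ℕ → ℝ} {x : ℝ}
    (hs : ∀ i ≤ m, HasDerivAt (fun z => s z i) (s' i) x) :
    HasDerivAt (fun z => vecOfSeq m (s z)) (vecOfSeq m s') x :=
  hasDerivAt_ofSeq (t := fun _ => 0) (t' := 0) (hasDerivAt_const x (0 : ℝ)) hs

/-- Linearization commutes with the total derivative. The speed `r` is kept because a contact
transformation carries solutions to curves that need not be parametrized by x. -/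
theorem hasDerivAt_linearization {m : ℕ} {g : Jet m → ℝ} {t : ℝ → ℝ} {s u : ℝ → ℕ → ℝ} {r x : ℝ}
    (hg : ContDiffAt ℝ ∞ g (ofSeq m (t x) (s x))) (ht : HasDerivAt t r x)
    (hs : ∀ i ≤ m, HasDerivAt (fun z => s z i) (r * s x (i + 1)) x)
    (hu : ∀ i ≤ m, HasDerivAt (fun z => u z i) (r * u x (i + 1)) x) :
    HasDerivAt (fun z => fderiv ℝ g (ofSeq m (t z) (s z)) (vecOfSeq m (u z)))
      (r * fderiv ℝ (totalDeriv g) (ofSeq (m + 1) (t x) (s x)) (vecOfSeq (m + 1) (u x))) x := by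
  have h := hasDerivAt_fderiv_curve hg (hasDerivAt_ofSeq ht hs) (hasDerivAt_vecOfSeq hu)
  have h1 : ofSeq m r (fun i => r * s x (i + 1)) =
      r • ((1, 0) + shiftL m (ofSeq (m + 1) (t x) (s x))) := by
    ext i <;> simp [shiftL, ofSeq]
  have h2 : vecOfSeq m (fun i => r * u x (i + 1)) = r • shiftL m (vecOfSeq (m + 1) (u x)) := by
    ext i <;> simp [shiftL, ofSeq, vecOfSeq]
  have h3 : truncL (Nat.le_succ m) (vecOfSeq (m + 1) (u x)) = vecOfSeq m (u x) := rfl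
  have h4 := fderiv_totalDeriv (g := g) (p := ofSeq (m + 1) (t x) (s x))
    (by rw [truncL_ofSeq]; exact hg) (vecOfSeq (m + 1) (u x))
  rw [truncL_ofSeq, h3] at h4
  rw [h1, h2] at h
  rw [h4, mul_add]
  refine h.congr_deriv ?_
  rw [map_smul, map_smul, smul_eq_mul, smul_eq_mul]

/-- The principal symbol: d^k g/dx^k depends on y_{n+k} only through the term (∂g/∂y_n) y_{n+k}. -/
theorem fderiv_iterTotalDeriv_of_top {n : ℕ} {g : Jet n → ℝ} {D : Set (Jet n)} (hD : IsOpen D)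
    (hg : ContDiffOn ℝ ∞ g D) {t : ℝ} {s : ℕ → ℝ} (hs : ofSeq n t s ∈ D) (k : ℕ) :
    ∀ u : ℕ → ℝ, (∀ i < n + k, u i = 0) →
      fderiv ℝ (iterTotalDeriv g k) (ofSeq (n + k) t s) (vecOfSeq (n + k) u) =
        u (n + k) * fderiv ℝ g (ofSeq n t s) (0, Pi.single (Fin.last n) 1) := by
  induction k with
  | zero =>
    intro u hu
    have h : vecOfSeq n u = u n • ((0, Pi.single (Fin.last n) 1) : Jet n) := by
      ext i
      · simp [vecOfSeq, ofSeq]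
      · by_cases h : i = Fin.last n
        · subst h; simp [vecOfSeq, ofSeq]
        · have h' := Fin.val_lt_last h
          simp [vecOfSeq, ofSeq, h, hu i h']
    change fderiv ℝ g (ofSeq n t s) (vecOfSeq n u) = _
    rw [h, map_smul]
    rfl
  | succ k ih =>
    intro u hu
    change fderiv ℝ (totalDeriv (iterTotalDeriv g k)) (ofSeq (n + k + 1) t s)
      (vecOfSeq (n + k + 1) u) = _
    rw [fderiv_totalDeriv (by exact contDiffAt_iterTotalDeriv hD hg k hs)]
    have h0 : truncL (Nat.le_succ (n + k)) (vecOfSeq (n + k + 1) u) = 0 := by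
      ext i
      · rfl
      · exact hu i (by have := i.isLt; omega)
    have h1 : shiftL (n + k) (vecOfSeq (n + k + 1) u) = vecOfSeq (n + k) fun i => u (i + 1) :=
      shiftL_ofSeq _ _ _
    rw [h0, h1, map_zero, zero_apply, zero_add]
    exact ih (fun i => u (i + 1)) fun i hi => hu _ (by omega)

end Jet

/-! ### The symplectic form of a Lagrangian -/

namespace Jet

/-- The linearization of `d^k/dx^k (∂f/∂y_i)` at the jets of `(t, s)`. -/
def linDerivPartial {n : ℕ} (f : Jet n → ℝ) (t : ℝ) (s : ℕ → ℝ) (i k : ℕ) : (ℕ → ℝ) →ₗ[ℝ] ℝ :=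
  (fderiv ℝ (iterTotalDeriv (fun p => fderiv ℝ f p (vecOfSeq n (Pi.single i 1))) k)
    (ofSeq (n + k) t s)).toLinearMap ∘ₗ vecOfSeq (n + k)

/-- The linearized momentum `∑_k (-1)^k d^k/dx^k (∂f/∂y_{i+k})`. -/
def linMomentum {n : ℕ} (f : Jet n → ℝ) (t : ℝ) (s : ℕ → ℝ) (i : ℕ) : (ℕ → ℝ) →ₗ[ℝ] ℝ :=
  ∑ k ∈ Finset.range (n + 1 - i), (-1 : ℝ) ^ k • linDerivPartial f t s (i + k) k

/-- The symplectic form `∑_{i<n} dy_i ∧ dp_i`, with `p_i` the Ostrogradsky momenta of `f`. -/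
def symplecticForm {n : ℕ} (f : Jet n → ℝ) (t : ℝ) (s : ℕ → ℝ) :
    LinearMap.BilinForm ℝ (ℕ → ℝ) :=
  ∑ i ∈ Finset.range n,
    (LinearMap.BilinForm.linMulLin (LinearMap.proj i) (linMomentum f t s (i + 1)) -
      LinearMap.BilinForm.linMulLin (linMomentum f t s (i + 1)) (LinearMap.proj i))

theorem symplecticForm_apply {n : ℕ} (f : Jet n → ℝ) (t : ℝ) (s u v : ℕ → ℝ) :
    symplecticForm f t s u v = ∑ i ∈ Finset.range n,
      (u i * linMomentum f t s (i + 1) v - linMomentum f t s (i + 1) u * v i) := by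
  simp [symplecticForm, LinearMap.sum_apply]

theorem symplecticForm_isAlt {n : ℕ} (f : Jet n → ℝ) (t : ℝ) (s : ℕ → ℝ) :
    (symplecticForm f t s).IsAlt := by
  intro u
  rw [symplecticForm_apply]
  exact Finset.sum_eq_zero fun i _ => by ring

theorem linMomentum_apply {n : ℕ} (f : Jet n → ℝ) (t : ℝ) (s : ℕ → ℝ) (i : ℕ) (u : ℕ → ℝ) :
    linMomentum f t s i u =
      ∑ k ∈ Finset.range (n + 1 - i), (-1 : ℝ) ^ k * linDerivPartial f t s (i + k) k u := by
  simp [linMomentum]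

theorem contDiffOn_fderiv_apply {n : ℕ} {f : Jet n → ℝ} {D : Set (Jet n)} (hD : IsOpen D)
    (hf : ContDiffOn ℝ ∞ f D) (w : Jet n) : ContDiffOn ℝ ∞ (fun p => fderiv ℝ f p w) D :=
  (hf.fderiv_of_isOpen hD (m := ∞) (by simp)).clm_apply contDiffOn_const

theorem linDerivPartial_zero {n : ℕ} {f : Jet n → ℝ} {D : Set (Jet n)} (hD : IsOpen D)
    (hf : ContDiffOn ℝ ∞ f D) {t : ℝ} {s : ℕ → ℝ} (hs : ofSeq n t s ∈ D) (i : ℕ) (u : ℕ → ℝ) :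
    linDerivPartial f t s i 0 u =
      fderiv ℝ (fderiv ℝ f) (ofSeq n t s) (vecOfSeq n u) (vecOfSeq n (Pi.single i 1)) := by
  have h := ((hasFDerivAt_fderiv (hf.contDiffAt (hD.mem_nhds hs))).clm_apply
    (hasFDerivAt_const (vecOfSeq n (Pi.single i 1)) (ofSeq n t s))).fderiv
  change fderiv ℝ (fun p => fderiv ℝ f p (vecOfSeq n (Pi.single i 1))) (ofSeq n t s)
    (vecOfSeq n u) = _
  rw [h]
  simp

theorem sum_smul_vecOfSeq_single (n : ℕ) (u : ℕ → ℝ) :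
    ∑ i ∈ Finset.range (n + 1), u i • vecOfSeq n (Pi.single i 1) = vecOfSeq n u := by
  simp_rw [← map_smul, ← map_sum]
  ext i
  · rfl
  · have := i.isLt
    change (∑ j ∈ Finset.range (n + 1), u j • Pi.single j (1 : ℝ)) (i : ℕ) = u i
    simp [Finset.sum_apply, Pi.single_apply]
    omega

theorem sum_mul_linDerivPartial_zero {n : ℕ} {f : Jet n → ℝ} {D : Set (Jet n)} (hD : IsOpen D)
    (hf : ContDiffOn ℝ ∞ f D) {t : ℝ} {s : ℕ → ℝ} (hs : ofSeq n t s ∈ D) (u v : ℕ → ℝ) :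
    ∑ i ∈ Finset.range (n + 1), u i * linDerivPartial f t s i 0 v =
      fderiv ℝ (fderiv ℝ f) (ofSeq n t s) (vecOfSeq n v) (vecOfSeq n u) := by
  conv_rhs => rw [← sum_smul_vecOfSeq_single n u, map_sum]
  refine Finset.sum_congr rfl fun i _ => ?_
  rw [linDerivPartial_zero hD hf hs, map_smul, smul_eq_mul]

/-- Both sides are the Hessian of `f` on the vertical vectors of `u` and `v`. -/
theorem sum_mul_linDerivPartial_zero_comm {n : ℕ} {f : Jet n → ℝ} {D : Set (Jet n)}
    (hD : IsOpen D) (hf : ContDiffOn ℝ ∞ f D) {t : ℝ} {s : ℕ → ℝ} (hs : ofSeq n t s ∈ D)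
    (u v : ℕ → ℝ) :
    ∑ i ∈ Finset.range (n + 1), u i * linDerivPartial f t s i 0 v =
      ∑ i ∈ Finset.range (n + 1), v i * linDerivPartial f t s i 0 u := by
  have hsymm : IsSymmSndFDerivAt ℝ f (ofSeq n t s) :=
    (hf.contDiffAt (hD.mem_nhds hs)).isSymmSndFDerivAt
      (by rw [minSmoothness_of_isRCLikeNormedField]
          exact WithTop.coe_le_coe.2 (le_top : (2 : ℕ∞) ≤ ⊤))
  rw [sum_mul_linDerivPartial_zero hD hf hs, sum_mul_linDerivPartial_zero hD hf hs, hsymm.eq]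

section Evolution

variable {n : ℕ} {f : Jet n → ℝ} {D : Set (Jet n)} {t : ℝ → ℝ} {s u v : ℝ → ℕ → ℝ} {r x : ℝ}

theorem hasDerivAt_linDerivPartial (hD : IsOpen D) (hf : ContDiffOn ℝ ∞ f D)
    (hx : ofSeq n (t x) (s x) ∈ D) (ht : HasDerivAt t r x)
    (hs : ∀ i < 2 * n, HasDerivAt (fun z => s z i) (r * s x (i + 1)) x)
    (hu : ∀ i < 2 * n, HasDerivAt (fun z => u z i) (r * u x (i + 1)) x) (i : ℕ) {k : ℕ}
    (hk : k < n) :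
    HasDerivAt (fun z => linDerivPartial f (t z) (s z) i k (u z))
      (r * linDerivPartial f (t x) (s x) i (k + 1) (u x)) x :=
  hasDerivAt_linearization
    (contDiffAt_iterTotalDeriv hD (contDiffOn_fderiv_apply hD hf _) k hx) ht
    (fun j hj => hs j (by omega)) (fun j hj => hu j (by omega))

/-- Linearization of the Ostrogradsky recursion dp_{i+1}/dx = ∂f/∂y_i - p_i, where p_0 is the
Euler–Lagrange expression. -/
theorem hasDerivAt_linMomentum (hD : IsOpen D) (hf : ContDiffOn ℝ ∞ f D)
    (hx : ofSeq n (t x) (s x) ∈ D) (ht : HasDerivAt t r x)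
    (hs : ∀ i < 2 * n, HasDerivAt (fun z => s z i) (r * s x (i + 1)) x)
    (hu : ∀ i < 2 * n, HasDerivAt (fun z => u z i) (r * u x (i + 1)) x) {i : ℕ} (hi : i < n) :
    HasDerivAt (fun z => linMomentum f (t z) (s z) (i + 1) (u z))
      (r * (linDerivPartial f (t x) (s x) i 0 (u x) - linMomentum f (t x) (s x) i (u x))) x := by
  simp_rw [linMomentum_apply]
  have h := HasDerivAt.fun_sum (u := Finset.range (n + 1 - (i + 1))) (x := x)
    (A := fun k z => (-1 : ℝ) ^ k * linDerivPartial f (t z) (s z) (i + 1 + k) k (u z))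
    fun k hk => (hasDerivAt_linDerivPartial hD hf hx ht hs hu (i + 1 + k)
      (by have := Finset.mem_range.1 hk; omega)).const_mul ((-1 : ℝ) ^ k)
  refine h.congr_deriv ?_
  rw [show n + 1 - i = (n + 1 - (i + 1)) + 1 by omega, Finset.sum_range_succ']
  simp only [pow_zero, one_mul, add_zero]
  rw [sub_add_cancel_right, ← Finset.sum_neg_distrib, Finset.mul_sum]
  refine Finset.sum_congr rfl fun k _ => ?_
  rw [show i + (k + 1) = i + 1 + k by omega, pow_succ]
  ring

theorem hasDerivAt_symplecticForm (hD : IsOpen D) (hf : ContDiffOn ℝ ∞ f D)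
    (hx : ofSeq n (t x) (s x) ∈ D) (ht : HasDerivAt t r x)
    (hs : ∀ i < 2 * n, HasDerivAt (fun z => s z i) (r * s x (i + 1)) x)
    (hu : ∀ i < 2 * n, HasDerivAt (fun z => u z i) (r * u x (i + 1)) x)
    (hv : ∀ i < 2 * n, HasDerivAt (fun z => v z i) (r * v x (i + 1)) x)
    (hu0 : linMomentum f (t x) (s x) 0 (u x) = 0) (hv0 : linMomentum f (t x) (s x) 0 (v x) = 0) :
    HasDerivAt (fun z => symplecticForm f (t z) (s z) (u z) (v z)) 0 x := by
  simp_rw [symplecticForm_apply]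
  have h := HasDerivAt.fun_sum (u := Finset.range n) (x := x)
    (A := fun i z => u z i * linMomentum f (t z) (s z) (i + 1) (v z) -
      linMomentum f (t z) (s z) (i + 1) (u z) * v z i)
    fun i hi => ((hu i (by have := Finset.mem_range.1 hi; omega)).mul
      (hasDerivAt_linMomentum hD hf hx ht hs hv (Finset.mem_range.1 hi))).sub
      ((hasDerivAt_linMomentum hD hf hx ht hs hu (Finset.mem_range.1 hi)).mul
      (hv i (by have := Finset.mem_range.1 hi; omega)))
  refine h.congr_deriv ?_
  -- By the recursion the derivative is r times a telescoping sum of T_{i+1} - T_i, with T_i = u_i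
  -- p_i(v) - p_i(u) v_i, plus the antisymmetrized Hessian truncated to i < n. T_0 vanishes by the
  -- linearized Euler–Lagrange equation. T_n is the missing i = n term of the Hessian, because p_n
  -- is the linearization of ∂f/∂y_n. The total is zero by symmetry.
  have hsym := sum_mul_linDerivPartial_zero_comm hD hf hx (u x) (v x)
  rw [Finset.sum_range_succ, Finset.sum_range_succ] at hsym
  have hlast : ∀ w, linMomentum f (t x) (s x) n w = linDerivPartial f (t x) (s x) n 0 w := by
    intro w
    simp [linMomentum_apply]
  have htel := Finset.sum_range_sub (fun i =>
    u x i * linMomentum f (t x) (s x) i (v x) - linMomentum f (t x) (s x) i (u x) * v x i) n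
  simp only [hu0, hv0, hlast, mul_zero, zero_mul, sub_zero] at htel
  have hsplit : ∀ a b c d : ℕ → ℝ, ∑ i ∈ Finset.range n, (a i - b i + (c i - d i)) =
      ∑ i ∈ Finset.range n, (a i - b i) +
        (∑ i ∈ Finset.range n, c i - ∑ i ∈ Finset.range n, d i) := by
    intro a b c d
    rw [Finset.sum_add_distrib, Finset.sum_sub_distrib c d]
  have hgoal := hsplit
    (fun i => u x (i + 1) * linMomentum f (t x) (s x) (i + 1) (v x) -
      linMomentum f (t x) (s x) (i + 1) (u x) * v x (i + 1))
    (fun i => u x i * linMomentum f (t x) (s x) i (v x) -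
      linMomentum f (t x) (s x) i (u x) * v x i)
    (fun i => u x i * linDerivPartial f (t x) (s x) i 0 (v x))
    (fun i => v x i * linDerivPartial f (t x) (s x) i 0 (u x))
  rw [htel] at hgoal
  have h0 : r * ∑ i ∈ Finset.range n,
      (u x (i + 1) * linMomentum f (t x) (s x) (i + 1) (v x) -
        linMomentum f (t x) (s x) (i + 1) (u x) * v x (i + 1) -
      (u x i * linMomentum f (t x) (s x) i (v x) -
        linMomentum f (t x) (s x) i (u x) * v x i) +
      (u x i * linDerivPartial f (t x) (s x) i 0 (v x) -
        v x i * linDerivPartial f (t x) (s x) i 0 (u x))) = 0 := by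
    rw [hgoal]
    linear_combination r * hsym
  rw [← h0, Finset.mul_sum]
  refine Finset.sum_congr rfl fun i _ => ?_
  ring

end Evolution

/-- The symplectic form pairs `∂/∂y_{2n-1}` with a vertical vector `v` to a nonzero multiple
of its first coordinate. -/
theorem symplecticForm_top {n : ℕ} {f : Jet n → ℝ} {D : Set (Jet n)} (hD : IsOpen D)
    (hf : ContDiffOn ℝ ∞ f D) {t : ℝ} {s : ℕ → ℝ} (hs : ofSeq n t s ∈ D) {N : ℕ}
    (hn : N + 1 = 2 * n) {u : ℕ → ℝ} (hu : ∀ i < N, u i = 0) (v : ℕ → ℝ) :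
    symplecticForm f t s u v =
      -((-1) ^ (n - 1) * (u N * partialY (partialY f (Fin.last n)) (Fin.last n) (ofSeq n t s)))
        * v 0 := by
  have hL : ∀ i k, n + k < N → linDerivPartial f t s i k u = 0 := by
    intro i k hk
    have h : vecOfSeq (n + k) u = 0 := by
      ext j
      · rfl
      · exact hu j (by have := j.isLt; omega)
    simp [linDerivPartial, h]
  obtain ⟨m, rfl⟩ : ∃ m, n = m + 1 := ⟨n - 1, by omega⟩
  obtain rfl : N = m + 1 + m := by omega
  -- Only the momentum conjugate to y_0 has order 2n - 1 and so sees u_N. All other momenta, and all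
  -- y_i with i < n, vanish on `u`.
  rw [symplecticForm_apply, Finset.sum_range_succ', Finset.sum_eq_zero]
  · have h1 : linMomentum f t s (0 + 1) u =
        (-1) ^ m * (u (m + 1 + m) *
          partialY (partialY f (Fin.last (m + 1))) (Fin.last (m + 1)) (ofSeq (m + 1) t s)) := by
      rw [linMomentum_apply, show m + 1 + 1 - (0 + 1) = m + 1 by omega, Finset.sum_range_succ,
        Finset.sum_eq_zero, zero_add, show 0 + 1 + m = m + 1 by omega]
      · congr 1
        have h2 : vecOfSeq (m + 1) (Pi.single (m + 1) 1) =
            ((0, Pi.single (Fin.last (m + 1)) 1) : Jet (m + 1)) := by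
          ext j
          · rfl
          · simp [vecOfSeq, ofSeq, Pi.single_apply, Fin.ext_iff]
        have h3 := fderiv_iterTotalDeriv_of_top hD (contDiffOn_fderiv_apply hD hf
          (vecOfSeq (m + 1) (Pi.single (m + 1) 1))) hs m u hu
        simp only [linDerivPartial, LinearMap.comp_apply, ContinuousLinearMap.coe_coe]
        rw [h3, h2]
        rfl
      · intro k hk
        rw [hL _ _ (by have := Finset.mem_range.1 hk; omega), mul_zero]
    rw [h1, hu 0 (by omega)]
    simp
  · intro i hi
    have hi' := Finset.mem_range.1 hi
    have h1 : linMomentum f t s (i + 1 + 1) u = 0 := by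
      rw [linMomentum_apply]
      refine Finset.sum_eq_zero fun k hk => ?_
      rw [hL _ _ (by have := Finset.mem_range.1 hk; omega), mul_zero]
    rw [h1, hu _ (by omega)]
    simp

end Jet

/-! ### The symplectic form of an Euler–Lagrange equation -/

/-- With `j` the inclusion of vertical vectors, this makes the vertical lift of a fixed tangent
vector of `Sol` differentiable along a solution. -/
theorem differentiableAt_inverse_fderiv_apply {V W : Type*} [NormedAddCommGroup V]
    [NormedSpace ℝ V] [NormedAddCommGroup W] [NormedSpace ℝ W] [CompleteSpace W] (j : W →L[ℝ] V)
    {g : V → W} {c : ℝ → V} {x : ℝ} (hg : ContDiffAt ℝ ∞ g (c x)) (hc : DifferentiableAt ℝ c x)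
    (hu : IsUnit ((fderiv ℝ g (c x)).comp j)) (w : W) :
    DifferentiableAt ℝ (fun z => Ring.inverse ((fderiv ℝ g (c z)).comp j) w) x := by
  have h1 : DifferentiableAt ℝ (fun z => fderiv ℝ g (c z)) x :=
    (hasFDerivAt_fderiv hg).differentiableAt.comp x hc
  have h2 : DifferentiableAt ℝ (fun z => (fderiv ℝ g (c z)).comp j) x :=
    h1.clm_comp (differentiableAt_const j)
  exact (h2.inverse hu).clm_apply (differentiableAt_const w)

theorem isUnit_of_ker_eq_zero {m : ℕ} (A : (Fin m → ℝ) →L[ℝ] (Fin m → ℝ))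
    (hA : ∀ v, A v = 0 → v = 0) : IsUnit A := by
  let e := (LinearEquiv.ofInjectiveEndo A.toLinearMap
    ((injective_iff_map_eq_zero A.toLinearMap).2 hA)).toContinuousLinearEquiv
  exact ⟨e.toUnit, by ext; rfl⟩

/-- The sequence `v 0, …, v m, a, a, …`. -/
def Jet.extend {m : ℕ} (v : Fin (m + 1) → ℝ) (a : ℝ) (i : ℕ) : ℝ :=
  if h : i < m + 1 then v ⟨i, h⟩ else a

namespace ScalarODE

open Jet

variable {N : ℕ}

/-- The coordinates of the point of the hypersurface over `p`. -/
def coords (E : ScalarODE N) (p : Jet N) : ℕ → ℝ := Jet.extend p.2 (E.F p)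

/-- The coordinates of the vertical tangent vector of the hypersurface at `p` over `v`. -/
def tangentCoords (E : ScalarODE N) (p : Jet N) : (Fin (N + 1) → ℝ) →ₗ[ℝ] (ℕ → ℝ) where
  toFun v := Jet.extend v (fderiv ℝ E.F p (0, v))
  map_add' v w := by
    ext i
    have h : fderiv ℝ E.F p (0, v + w) = fderiv ℝ E.F p (0, v) + fderiv ℝ E.F p (0, w) := by
      rw [← map_add, Prod.mk_add_mk, add_zero]
    by_cases hi : i < N + 1
    · simp [Jet.extend, hi]
    · simp only [Jet.extend, hi, dite_false, Pi.add_apply, h]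
  map_smul' a v := by
    ext i
    have h : fderiv ℝ E.F p (0, a • v) = a • fderiv ℝ E.F p (0, v) := by
      rw [← map_smul, Prod.smul_mk, smul_zero]
    by_cases hi : i < N + 1
    · simp [Jet.extend, hi]
    · simp only [Jet.extend, hi, dite_false, Pi.smul_apply, h, RingHom.id_apply]

theorem differentiableAt_F (E : ScalarODE N) {p : Jet N} (hp : p ∈ E.domain) :
    DifferentiableAt ℝ E.F p :=
  (E.smooth.contDiffAt (E.isOpen_domain.mem_nhds hp)).differentiableAt (by simp)

theorem partialY_eq {n : ℕ} (f : Jet n → ℝ) (i : Fin (n + 1)) :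
    partialY f i = fun p => fderiv ℝ f p (vecOfSeq n (Pi.single (i : ℕ) 1)) := by
  have h : vecOfSeq n (Pi.single (i : ℕ) 1) = ((0, Pi.single i 1) : Jet n) := by
    ext j
    · rfl
    · simp [vecOfSeq, ofSeq, Pi.single_apply, Fin.ext_iff]
  rw [h]
  rfl

theorem eulerLagrange_ofSeq {n M : ℕ} (f : Jet n → ℝ) (h : 2 * n ≤ M) (t : ℝ) (s : ℕ → ℝ) :
    eulerLagrange f h (ofSeq M t s) = ∑ k ∈ Finset.range (n + 1), (-1 : ℝ) ^ k *
      iterTotalDeriv (fun p => fderiv ℝ f p (vecOfSeq n (Pi.single k 1))) k (ofSeq (n + k) t s) := by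
  rw [Finset.sum_range]
  refine Finset.sum_congr rfl fun i _ => ?_
  rw [partialY_eq]
  rfl

theorem coords_mem_hypersurface (E : ScalarODE N) {p : Jet N} (hp : p ∈ E.domain) :
    ofSeq (N + 1) p.1 (E.coords p) ∈ E.hypersurface := by
  have h : trunc (Nat.le_succ N) (ofSeq (N + 1) p.1 (E.coords p)) = p := by
    ext i
    · rfl
    · have := i.isLt
      simp [trunc, ofSeq, coords, Jet.extend]
      omega
  refine ⟨by rwa [h], ?_⟩
  rw [h]
  simp [ofSeq, coords, Jet.extend]

theorem hasDerivAt_extend {m : ℕ} {v : ℝ → Fin (m + 1) → ℝ} {a : ℝ → ℝ} {v' : Fin (m + 1) → ℝ}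
    {a' x : ℝ} (hv : HasDerivAt v v' x) (ha : HasDerivAt a a' x) (i : ℕ) :
    HasDerivAt (fun z => Jet.extend (v z) (a z) i) (Jet.extend v' a' i) x := by
  unfold Jet.extend
  split_ifs with h
  · exact hasDerivAt_pi.1 hv ⟨i, h⟩
  · exact ha

/-- The linearization of the Euler–Lagrange equation vanishes on tangent vectors. -/
theorem linMomentum_zero_tangentCoords (E : ScalarODE N) {n : ℕ} (hn : N + 1 = 2 * n)
    {D : Set (Jet n)} {f : Jet n → ℝ} (hD : IsOpen D) (hf : ContDiffOn ℝ ∞ f D)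
    (hdom : ∀ p ∈ E.domain, ofSeq n p.1 (E.coords p) ∈ D)
    (hEL : ∀ p ∈ E.hypersurface, eulerLagrange f hn.ge p = 0) {p : Jet N} (hp : p ∈ E.domain)
    (v : Fin (N + 1) → ℝ) :
    linMomentum f p.1 (E.coords p) 0 (E.tangentCoords p v) = 0 := by
  -- The Euler–Lagrange identity is differentiated along the vertical line through p with direction
  -- v, lifted to the hypersurface by y_{N+1} = F.
  have hline : HasDerivAt (fun z : ℝ => p + z • ((0, v) : Jet N)) (0, v) 0 := by
    simpa using ((hasDerivAt_id (0 : ℝ)).smul_const ((0, v) : Jet N)).const_add p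
  have hp0 : p + (0 : ℝ) • ((0, v) : Jet N) = p := by simp
  have hF : HasDerivAt (fun z : ℝ => E.F (p + z • ((0, v) : Jet N))) (fderiv ℝ E.F p (0, v)) 0 :=
    HasFDerivAt.comp_hasDerivAt (f := fun z : ℝ => p + z • ((0, v) : Jet N)) 0
      (by rw [hp0]; exact (E.differentiableAt_F hp).hasFDerivAt) hline
  have hv : HasDerivAt (fun z : ℝ => (p + z • ((0, v) : Jet N)).2) v 0 := by
    simpa using ((hasDerivAt_id (0 : ℝ)).smul_const v).const_add p.2
  have hc : ∀ m, HasDerivAt (fun z : ℝ => ofSeq m p.1 (E.coords (p + z • ((0, v) : Jet N))))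
      (vecOfSeq m (E.tangentCoords p v)) 0 := fun m =>
    hasDerivAt_ofSeq (t := fun _ => p.1) (t' := 0) (hasDerivAt_const _ _)
      fun i _ => hasDerivAt_extend hv hF i
  have hk : ∀ k, HasDerivAt (fun z : ℝ =>
      iterTotalDeriv (fun p => fderiv ℝ f p (vecOfSeq n (Pi.single k 1))) k
        (ofSeq (n + k) p.1 (E.coords (p + z • ((0, v) : Jet N)))))
      (linDerivPartial f p.1 (E.coords p) k k (E.tangentCoords p v)) 0 := fun k =>
    HasFDerivAt.comp_hasDerivAt
      (f := fun z : ℝ => ofSeq (n + k) p.1 (E.coords (p + z • ((0, v) : Jet N)))) 0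
      (by
        rw [hp0]
        exact ((contDiffAt_iterTotalDeriv hD (contDiffOn_fderiv_apply hD hf _) k
          (hdom p hp)).differentiableAt (by simp)).hasFDerivAt) (hc (n + k))
  have hsum := HasDerivAt.fun_sum (u := Finset.range (n + 1))
    fun k _ => (hk k).const_mul ((-1 : ℝ) ^ k)
  rw [linMomentum_apply]
  simp only [zero_add]
  refine hsum.unique ((hasDerivAt_const (0 : ℝ) (0 : ℝ)).congr_of_eventuallyEq ?_)
  have hnear : ∀ᶠ z : ℝ in nhds 0, p + z • ((0, v) : Jet N) ∈ E.domain := by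
    have hcont : ContinuousAt (fun z : ℝ => p + z • ((0, v) : Jet N)) 0 := hline.continuousAt
    exact hcont.eventually (E.isOpen_domain.mem_nhds (by simpa using hp))
  filter_upwards [hnear] with z hz
  have h := hEL _ (E.coords_mem_hypersurface hz)
  rw [eulerLagrange_ofSeq] at h
  simpa using h

/-- The vertical vector over `w` for a first-integral map, transported along a (reparametrized)
integral curve, obeys the linearized equation. -/
theorem hasDerivAt_inverse_fderiv (E : ScalarODE N) {π : Jet N → (Fin (N + 1) → ℝ)}
    {U : Set (Jet N)} (hU : IsOpen U) (hUE : U ⊆ E.domain) (hπ : ContDiffOn ℝ ∞ π U)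
    (hker : ∀ p ∈ U, fderiv ℝ π p (E.field p) = 0) {I : Set ℝ} (hI : IsOpen I) {c : ℝ → Jet N}
    {r : ℝ → ℝ} (hcU : ∀ x ∈ I, c x ∈ U) (hc : ∀ x ∈ I, HasDerivAt c (r x • E.field (c x)) x)
    (hinj : ∀ x ∈ I, ∀ v : Fin (N + 1) → ℝ, fderiv ℝ π (c x) (0, v) = 0 → v = 0)
    (w : Fin (N + 1) → ℝ) {x : ℝ} (hx : x ∈ I) :
    HasDerivAt (fun z => Ring.inverse ((fderiv ℝ π (c z)).comp
        (ContinuousLinearMap.inr ℝ ℝ (Fin (N + 1) → ℝ))) w)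
      (r x • fderiv ℝ E.field (c x) (0, Ring.inverse ((fderiv ℝ π (c x)).comp
        (ContinuousLinearMap.inr ℝ ℝ (Fin (N + 1) → ℝ))) w)).2 x := by
  have hunit : ∀ z ∈ I, IsUnit ((fderiv ℝ π (c z)).comp
      (ContinuousLinearMap.inr ℝ ℝ (Fin (N + 1) → ℝ))) := fun z hz =>
    isUnit_of_ker_eq_zero _ fun v hv => hinj z hz v hv
  have hd := (differentiableAt_inverse_fderiv_apply
    (ContinuousLinearMap.inr ℝ ℝ (Fin (N + 1) → ℝ)) (hπ.contDiffAt (hU.mem_nhds (hcU x hx)))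
    (hc x hx).differentiableAt (hunit x hx) w).hasDerivAt
  set v : ℝ → (Fin (N + 1) → ℝ) := fun z => Ring.inverse ((fderiv ℝ π (c z)).comp
        (ContinuousLinearMap.inr ℝ ℝ (Fin (N + 1) → ℝ))) w with hv
  have hAv : ∀ z ∈ I, fderiv ℝ π (c z) (0, v z) = w := fun z hz =>
    DFunLike.congr_fun (Ring.mul_inverse_cancel _ (hunit z hz)) w
  -- The image of the lift is the constant w, so dπ kills its derivative minus the linearized flow;
  -- injectivity on vertical vectors then gives the equation.
  have h1 := E.hasDerivAt_fderiv_apply hU hUE hπ hker (hcU x hx) (hc x hx)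
    ((hasDerivAt_const x (0 : ℝ)).prodMk hd)
  have h2 := h1.unique ((hasDerivAt_const x w).congr_of_eventuallyEq (by
    filter_upwards [hI.mem_nhds hx] with z hz using hAv z hz))
  have h3 : ((0, deriv v x) : Jet N) - r x • fderiv ℝ E.field (c x) (0, v x) =
      (0, deriv v x - (r x • fderiv ℝ E.field (c x) (0, v x)).2) := by
    refine Prod.ext ?_ rfl
    simp [E.fderiv_field_fst (hUE (hcU x hx))]
  rw [h3] at h2
  rw [sub_eq_zero.1 (hinj x hx _ h2)] at hd
  exact hd

theorem extend_smul_fderiv_field (E : ScalarODE N) {p : Jet N} (hp : p ∈ E.domain) (r : ℝ)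
    (v : Fin (N + 1) → ℝ) {a : ℝ} {i : ℕ} (hi : i < N + 1) :
    Jet.extend (r • fderiv ℝ E.field p (0, v)).2 a i = r * E.tangentCoords p v (i + 1) := by
  have h : Jet.extend (r • fderiv ℝ E.field p (0, v)).2 a i =
      r * (fderiv ℝ E.field p (0, v)).2 ⟨i, hi⟩ := by
    simp [Jet.extend, hi]
  rw [h]
  congr 1
  rcases (Nat.lt_succ_iff.1 hi).lt_or_eq with h' | rfl
  · exact (E.fderiv_field_castSucc hp (0, v) ⟨i, h'⟩).trans (by
      simp [tangentCoords, Jet.extend, h'])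
  · exact (E.fderiv_field_last hp (0, v)).trans (by simp [tangentCoords, Jet.extend])

theorem extend_smul_field (E : ScalarODE N) (p : Jet N) (r : ℝ) {a : ℝ} {i : ℕ}
    (hi : i < N + 1) : Jet.extend (r • E.field p).2 a i = r * E.coords p (i + 1) := by
  have h : Jet.extend (r • E.field p).2 a i = r * (E.field p).2 ⟨i, hi⟩ := by
    simp [Jet.extend, hi]
  rw [h]
  congr 1
  rcases (Nat.lt_succ_iff.1 hi).lt_or_eq with h' | rfl
  · have h2 : (⟨i, hi⟩ : Fin (N + 1)) = Fin.castSucc ⟨i, h'⟩ := rfl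
    have h3 : E.coords p (i + 1) = p.2 (Fin.succ ⟨i, h'⟩) := by
      simp [coords, Jet.extend, h']
    rw [h2, h3]
    exact Fin.snoc_castSucc (α := fun _ => ℝ) (E.F p) (fun j : Fin N => p.2 j.succ) ⟨i, h'⟩
  · have h2 : (⟨i, hi⟩ : Fin (i + 1)) = Fin.last i := rfl
    rw [h2]
    simp [field, coords, Jet.extend]

theorem ofSeq_coords (E : ScalarODE N) {m : ℕ} (h : m ≤ N) (p : Jet N) :
    ofSeq m p.1 (E.coords p) = trunc h p := by
  ext i
  · rfl
  · have := i.isLt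
    simp only [ofSeq, coords, Jet.extend, trunc]
    rw [dif_pos (by omega)]
    rfl

/-- The symplectic form on the tangent space of the space of solutions of an Euler–Lagrange
equation. -/
theorem IsEulerLagrange.exists_bilinForm {E : ScalarODE N} (hE : E.IsEulerLagrange)
    {π : Jet N → (Fin (N + 1) → ℝ)}
    {U : Set (Jet N)} (hU : IsOpen U) (hUE : U ⊆ E.domain) (hπ : ContDiffOn ℝ ∞ π U)
    (hker : ∀ p ∈ U, fderiv ℝ π p (E.field p) = 0) {I : Set ℝ} (hI : IsOpen I)
    (hIc : I.OrdConnected) (hI0 : I.Nonempty) {c : ℝ → Jet N}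
    {r : ℝ → ℝ} (hcU : ∀ x ∈ I, c x ∈ U) (hc : ∀ x ∈ I, HasDerivAt c (r x • E.field (c x)) x)
    (hinj : ∀ x ∈ I, ∀ v : Fin (N + 1) → ℝ, fderiv ℝ π (c x) (0, v) = 0 → v = 0) :
    ∃ B : LinearMap.BilinForm ℝ (Fin (N + 1) → ℝ), B.IsAlt ∧ ∀ x ∈ I, ∃ b : ℝ, b ≠ 0 ∧
      ∀ v : Fin (N + 1) → ℝ, B (fderiv ℝ π (c x) (0, Pi.single (Fin.last N) 1))
        (fderiv ℝ π (c x) (0, v)) = b * v 0 := by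
  obtain ⟨n, hn, D, f, hD, hf, hreg, hdom, hEL⟩ := hE
  obtain ⟨x₀, hx₀⟩ := hI0
  have hn' : n ≤ N := by omega
  have hdom' : ∀ p ∈ E.domain, ofSeq n p.1 (E.coords p) ∈ D := by
    intro p hp
    rw [E.ofSeq_coords hn']
    exact hdom p hp
  have hEL' : ∀ p ∈ E.hypersurface, eulerLagrange f hn.ge p = 0 := fun p hp => (hEL p hp.1).1 hp
  have hcE : ∀ x ∈ I, c x ∈ E.domain := fun x hx => hUE (hcU x hx)
  -- `L z` lifts a tangent vector of `Sol` to the vertical vector at c(z) above it, then appends the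
  -- y_{N+1} coordinate forced by tangency to the hypersurface.
  set L : ℝ → (Fin (N + 1) → ℝ) →ₗ[ℝ] (ℕ → ℝ) := fun z => E.tangentCoords (c z) ∘ₗ
    (Ring.inverse ((fderiv ℝ π (c z)).comp
      (ContinuousLinearMap.inr ℝ ℝ (Fin (N + 1) → ℝ)))).toLinearMap with hL
  have hLA : ∀ x ∈ I, ∀ v, L x (fderiv ℝ π (c x) (0, v)) = E.tangentCoords (c x) v := by
    intro x hx v
    have hunit : IsUnit ((fderiv ℝ π (c x)).comp
      (ContinuousLinearMap.inr ℝ ℝ (Fin (N + 1) → ℝ))) :=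
      isUnit_of_ker_eq_zero _ fun v hv => hinj x hx v hv
    exact congrArg (E.tangentCoords (c x))
      (DFunLike.congr_fun (Ring.inverse_mul_cancel _ hunit) v)
  have ht : ∀ x ∈ I, HasDerivAt (fun z => (c z).1) (r x) x := by
    intro x hx
    have h := (ContinuousLinearMap.fst ℝ ℝ (Fin (N + 1) → ℝ)).hasFDerivAt.comp_hasDerivAt x (hc x hx)
    exact h.congr_deriv (by simp [field])
  have hs : ∀ x ∈ I, ∀ i < 2 * n,
      HasDerivAt (fun z => E.coords (c z) i) (r x * E.coords (c x) (i + 1)) x := by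
    intro x hx i hi
    have h := (ContinuousLinearMap.snd ℝ ℝ (Fin (N + 1) → ℝ)).hasFDerivAt.comp_hasDerivAt x (hc x hx)
    rw [← E.extend_smul_field (c x) (r x) (by omega)]
    exact hasDerivAt_extend h
      ((E.differentiableAt_F (hcE x hx)).hasFDerivAt.comp_hasDerivAt x (hc x hx)) i
  have hu : ∀ w, ∀ x ∈ I, ∀ i < 2 * n,
      HasDerivAt (fun z => L z w i) (r x * L x w (i + 1)) x := by
    intro w x hx i hi
    have h := E.hasDerivAt_inverse_fderiv hU hUE hπ hker hI hcU hc hinj w hx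
    have h2 := hasDerivAt_pi.1 h ⟨i, by omega⟩
    -- The padding value 0 is immaterial, since i < N + 1.
    rw [hL, LinearMap.comp_apply, ← E.extend_smul_fderiv_field (hcE x hx) (r x) _ (a := 0)
      (by omega)]
    have h3 : ∀ (v : Fin (N + 1) → ℝ) a, Jet.extend v a i = v ⟨i, by omega⟩ := fun v a =>
      dif_pos _
    rw [h3]
    refine h2.congr_of_eventuallyEq (Filter.Eventually.of_forall fun z => ?_)
    exact h3 _ _
  -- The form built at x₀ can be computed at any other point of the solution; this is where
  -- connectedness of `I` enters.
  have hconst : ∀ w w', ∀ x ∈ I,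
      symplecticForm f (c x₀).1 (E.coords (c x₀)) (L x₀ w) (L x₀ w') =
        symplecticForm f (c x).1 (E.coords (c x)) (L x w) (L x w') := by
    intro w w' x hx
    have hd : ∀ z ∈ I, HasDerivAt (fun z =>
        symplecticForm f (c z).1 (E.coords (c z)) (L z w) (L z w')) 0 z := fun z hz =>
      hasDerivAt_symplecticForm hD hf (hdom' _ (hcE z hz)) (ht z hz) (hs z hz) (hu w z hz)
        (hu w' z hz) (E.linMomentum_zero_tangentCoords hn hD hf hdom' hEL' (hcE z hz) _)
        (E.linMomentum_zero_tangentCoords hn hD hf hdom' hEL' (hcE z hz) _)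
    exact hI.is_const_of_deriv_eq_zero hIc.isPreconnected
      (fun z hz => (hd z hz).differentiableAt.differentiableWithinAt)
      (fun z hz => (hd z hz).deriv) hx₀ hx
  refine ⟨(symplecticForm f (c x₀).1 (E.coords (c x₀))).comp (L x₀) (L x₀),
    fun w => symplecticForm_isAlt f _ _ _, fun x hx => ?_⟩
  have hDx := hdom' _ (hcE x hx)
  -- The constant of `symplecticForm_top` for u = ∂/∂y_N, whose top coordinate is the factor 1.
  refine ⟨-((-1) ^ (n - 1) * (1 * partialY (partialY f (Fin.last n)) (Fin.last n)
    (ofSeq n (c x).1 (E.coords (c x))))),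
    neg_ne_zero.2 (mul_ne_zero (pow_ne_zero _ (by norm_num)) (by simpa using hreg _ hDx)), ?_⟩
  intro v
  rw [LinearMap.BilinForm.comp_apply, hconst _ _ x hx, hLA x hx, hLA x hx]
  have htop : E.tangentCoords (c x) (Pi.single (Fin.last N) 1) N = 1 := by
    simp only [tangentCoords, LinearMap.coe_mk, AddHom.coe_mk, Jet.extend]
    rw [dif_pos (Nat.lt_succ_self N)]
    exact Pi.single_eq_same (M := fun _ : Fin (N + 1) => ℝ) (Fin.last N) 1
  have hlow : ∀ i < N, E.tangentCoords (c x) (Pi.single (Fin.last N) 1) i = 0 := by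
    intro i hi
    simp only [tangentCoords, LinearMap.coe_mk, AddHom.coe_mk, Jet.extend]
    rw [dif_pos (by omega)]
    exact Pi.single_eq_of_ne (M := fun _ : Fin (N + 1) => ℝ)
      (fun h => by simp [Fin.ext_iff] at h; omega) 1
  have h0 : E.tangentCoords (c x) v 0 = v 0 := by
    simp [tangentCoords, Jet.extend]
  rw [symplecticForm_top hD hf hDx hn hlow, htop, h0]

end ScalarODE

/-! ### Contact transformations -/

namespace ScalarODE

open Jet

section Contact

variable {k : ℕ} {Φ : OpenPartialHomeomorph (Jet k) (Jet k)}

theorem IsContactTransformation.hasFDerivAt (h : IsContactTransformation Φ) {p : Jet k}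
    (hp : p ∈ Φ.source) : HasFDerivAt Φ (fderiv ℝ Φ p) p :=
  ((h.smooth.contDiffAt (Φ.open_source.mem_nhds hp)).differentiableAt (by simp)).hasFDerivAt

theorem IsContactTransformation.hasFDerivAt_symm (h : IsContactTransformation Φ) {q : Jet k}
    (hq : q ∈ Φ.target) : HasFDerivAt Φ.symm (fderiv ℝ Φ.symm q) q :=
  ((h.smooth_symm.contDiffAt (Φ.open_target.mem_nhds hq)).differentiableAt (by simp)).hasFDerivAt

theorem IsContactTransformation.fderiv_symm_fderiv (h : IsContactTransformation Φ) {p : Jet k}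
    (hp : p ∈ Φ.source) (v : Jet k) : fderiv ℝ Φ.symm (Φ p) (fderiv ℝ Φ p v) = v := by
  have h1 := (h.hasFDerivAt_symm (Φ.map_source hp)).comp p (h.hasFDerivAt hp)
  have h2 : HasFDerivAt (Φ.symm ∘ Φ) (ContinuousLinearMap.id ℝ (Jet k)) p :=
    (hasFDerivAt_id p).congr_of_eventuallyEq (Φ.eventually_left_inverse hp)
  exact DFunLike.congr_fun (h1.unique h2) v

theorem IsContactTransformation.fderiv_fderiv_symm (h : IsContactTransformation Φ) {p : Jet k}
    (hp : p ∈ Φ.source) (v : Jet k) : fderiv ℝ Φ p (fderiv ℝ Φ.symm (Φ p) v) = v := by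
  have hq := Φ.map_source hp
  have h0 : HasFDerivAt Φ (fderiv ℝ Φ p) (Φ.symm (Φ p)) := by
    rw [Φ.left_inv hp]; exact h.hasFDerivAt hp
  have h1 := h0.comp (Φ p) (h.hasFDerivAt_symm hq)
  have h2 : HasFDerivAt (Φ ∘ Φ.symm) (ContinuousLinearMap.id ℝ (Jet k)) (Φ p) :=
    (hasFDerivAt_id (Φ p)).congr_of_eventuallyEq (Φ.eventually_right_inverse hq)
  exact DFunLike.congr_fun (h1.unique h2) v

theorem IsContactTransformation.fderiv_ne_zero (h : IsContactTransformation Φ) {p : Jet k}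
    (hp : p ∈ Φ.source) {v : Jet k} (hv : v ≠ 0) : fderiv ℝ Φ p v ≠ 0 := by
  intro h0
  have := h.fderiv_symm_fderiv hp v
  rw [h0, map_zero] at this
  exact hv this.symm

theorem IsProlongation.truncL_fderiv {Φ' : OpenPartialHomeomorph (Jet (k + 1)) (Jet (k + 1))}
    (hΦ : IsContactTransformation Φ) (h : IsProlongation Φ Φ') {p : Jet (k + 1)}
    (hp : p ∈ Φ'.source) (v : Jet (k + 1)) :
    truncL (Nat.le_succ k) (fderiv ℝ Φ' p v) =
      fderiv ℝ Φ (trunc (Nat.le_succ k) p) (truncL (Nat.le_succ k) v) := by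
  have h1 := (truncL (Nat.le_succ k)).hasFDerivAt.comp p (h.contact.hasFDerivAt hp)
  have h0 : HasFDerivAt Φ (fderiv ℝ Φ (trunc (Nat.le_succ k) p)) (truncL (Nat.le_succ k) p) :=
    hΦ.hasFDerivAt (h.trunc_mem p hp)
  have h2 := h0.comp p (truncL (Nat.le_succ k)).hasFDerivAt
  have h3 := h2.congr_of_eventuallyEq (f₁ := truncL (Nat.le_succ k) ∘ Φ') (by
    filter_upwards [Φ'.open_source.mem_nhds hp] with q hq using h.trunc_map q hq)
  exact DFunLike.congr_fun (h1.unique h3) v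

end Contact

section Tower

variable {N : ℕ} {Φ : (k : ℕ) → OpenPartialHomeomorph (Jet k) (Jet k)}

theorem isContactTransformation_of_tower (h1 : IsContactTransformation (Φ 1))
    (hΦ : ∀ k, 1 ≤ k → k ≤ N → IsProlongation (Φ k) (Φ (k + 1))) {k : ℕ} (hk : 1 ≤ k)
    (hkN : k ≤ N + 1) : IsContactTransformation (Φ k) := by
  obtain ⟨j, rfl⟩ : ∃ j, k = j + 1 := ⟨k - 1, by omega⟩
  rcases Nat.eq_zero_or_pos j with rfl | hj
  · exact h1
  · exact (hΦ j hj (by omega)).contact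

/-- The contact form `dy₀ - y₁ dx` is preserved, up to a factor, by prolonged contact
transformations. -/
theorem contact_form_of_tower (h1 : IsContactTransformation (Φ 1))
    (hΦ : ∀ k, 1 ≤ k → k ≤ N → IsProlongation (Φ k) (Φ (k + 1))) (k : ℕ) (hk : k ≤ N) :
    ∀ p ∈ (Φ (k + 1)).source, ∀ v : Jet (k + 1), v.2 0 = p.2 1 * v.1 →
      (fderiv ℝ (Φ (k + 1)) p v).2 0 = (Φ (k + 1) p).2 1 * (fderiv ℝ (Φ (k + 1)) p v).1 := by
  induction k with
  | zero =>
    intro p hp v hv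
    exact h1.map_cartan p hp v (fun i => by rw [Subsingleton.elim i 0]; exact hv) 0
  | succ k ih =>
    intro p hp v hv
    have hpro := hΦ (k + 1) (by omega) hk
    have h := ih (by omega) _ (hpro.trunc_mem p hp) (truncL (Nat.le_succ (k + 1)) v) hv
    rw [← hpro.truncL_fderiv (isContactTransformation_of_tower h1 hΦ (by omega) (by omega)) hp,
      ← hpro.trunc_map p hp] at h
    exact h

variable {E E' : ScalarODE N}

theorem field_eq_ofSeq (E : ScalarODE N) (p : Jet N) :
    E.field p = truncL (Nat.le_succ N) (ofSeq (N + 1) 1 fun i => E.coords p (i + 1)) := by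
  ext i
  · rfl
  · have h := E.extend_smul_field p 1 (a := 0) i.isLt
    rw [one_smul, one_mul] at h
    exact (dif_pos i.isLt).symm.trans h

theorem trunc_ofSeq_coords (E : ScalarODE N) (p : Jet N) :
    trunc (Nat.le_succ N) (ofSeq (N + 1) p.1 (E.coords p)) = p :=
  E.ofSeq_coords le_rfl p

/-- A contact transformation whose prolongation maps `E` to `E'` maps the line distribution of
solutions of `E` to that of `E'`. -/
theorem fderiv_field_of_isProlongation {Ψ : OpenPartialHomeomorph (Jet N) (Jet N)}
    {Ψ' : OpenPartialHomeomorph (Jet (N + 1)) (Jet (N + 1))} (hΨ : IsContactTransformation Ψ)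
    (h : IsProlongation Ψ Ψ') (hsrc : E.hypersurface ⊆ Ψ'.source)
    (himg : Ψ' '' E.hypersurface = E'.hypersurface) {p : Jet N} (hp : p ∈ E.domain) :
    p ∈ Ψ.source ∧ Ψ p ∈ E'.domain ∧ (fderiv ℝ Ψ p (E.field p)).1 ≠ 0 ∧
      fderiv ℝ Ψ p (E.field p) = (fderiv ℝ Ψ p (E.field p)).1 • E'.field (Ψ p) := by
  set q := ofSeq (N + 1) p.1 (E.coords p) with hq
  have hqE := E.coords_mem_hypersurface hp
  have hqs : q ∈ Ψ'.source := hsrc hqE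
  have hqt : trunc (Nat.le_succ N) q = p := E.trunc_ofSeq_coords p
  have hps : p ∈ Ψ.source := hqt ▸ h.trunc_mem q hqs
  have hmap : trunc (Nat.le_succ N) (Ψ' q) = Ψ p := hqt ▸ h.trunc_map q hqs
  have hq' : Ψ' q ∈ E'.hypersurface := himg ▸ Set.mem_image_of_mem _ hqE
  have hdom : Ψ p ∈ E'.domain := hmap ▸ hq'.1
  -- A lift of the field to the Cartan distribution of J^{N+1}. Its last coordinate is arbitrary:
  -- the Cartan condition does not restrict it, the truncation forgets it, and `w` need not be
  -- tangent to the hypersurface.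
  set w := ofSeq (N + 1) 1 fun i => E.coords p (i + 1) with hw
  have hwc : w ∈ cartan q := by
    intro i
    simp [hw, hq, ofSeq]
  have hcart := h.contact.map_cartan q hqs w hwc
  have htr := h.truncL_fderiv hΨ hqs w
  rw [hqt, ← E.field_eq_ofSeq] at htr
  have heq : fderiv ℝ Ψ p (E.field p) = (fderiv ℝ Ψ p (E.field p)).1 • E'.field (Ψ p) := by
    rw [← htr]
    ext i
    · simp [field]
    · have hi := hcart i
      have hval : (Ψ' q).2 i.succ = (E'.field (Ψ p)).2 i := by
        induction i using Fin.lastCases with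
        | last =>
          have hl := hq'.2
          rw [hmap] at hl
          simpa [field] using hl
        | cast i =>
          rw [← hmap]
          simp only [field, Fin.snoc_castSucc]
          rfl
      rw [hval] at hi
      simp only [Prod.smul_snd, Pi.smul_apply, smul_eq_mul]
      exact hi.trans (mul_comm _ _)
  refine ⟨hps, hdom, fun h0 => ?_, heq⟩
  rw [h0, zero_smul] at heq
  refine hΨ.fderiv_ne_zero hps (fun h => ?_) heq
  have : (E.field p).1 = 0 := by rw [h]; rfl
  simp [field] at this

end Tower

end ScalarODE

/-! ### The linearization curve of a variational equation -/

namespace ScalarODE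

open Jet

variable {N : ℕ} {E E' : ScalarODE N} {I : Set ℝ} {y : ℝ → ℝ} {π : Jet N → (Fin (N + 1) → ℝ)}
  {U : Set (Jet N)}

/-- The field spanning the kernel has x-component 1, so no nonzero multiple of it is vertical. -/
theorem eq_zero_of_fderiv_vertical
    (hker : ∀ p ∈ U, LinearMap.ker (fderiv ℝ π p : Jet N →ₗ[ℝ] (Fin (N + 1) → ℝ)) =
      Submodule.span ℝ {E.field p}) {p : Jet N} (hp : p ∈ U) {v : Fin (N + 1) → ℝ}
    (hv : fderiv ℝ π p (0, v) = 0) : v = 0 := by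
  have h : ((0, v) : Jet N) ∈ Submodule.span ℝ {E.field p} := by
    rw [← hker p hp]; exact hv
  obtain ⟨a, ha⟩ := Submodule.mem_span_singleton.1 h
  have h1 : a = 0 := by simpa [field] using congrArg Prod.fst ha
  rw [h1, zero_smul] at ha
  exact (congrArg Prod.snd ha).symm

theorem fderiv_field_eq_zero
    (hker : ∀ p ∈ U, LinearMap.ker (fderiv ℝ π p : Jet N →ₗ[ℝ] (Fin (N + 1) → ℝ)) =
      Submodule.span ℝ {E.field p}) {p : Jet N} (hp : p ∈ U) : fderiv ℝ π p (E.field p) = 0 := by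
  have h : E.field p ∈ LinearMap.ker (fderiv ℝ π p : Jet N →ₗ[ℝ] (Fin (N + 1) → ℝ)) := by
    rw [hker p hp]; exact Submodule.mem_span_singleton_self _
  exact h

theorem vertical_one (N : ℕ) :
    vertical N 1 = Submodule.span ℝ {((0, Pi.single (Fin.last N) 1) : Jet N)} := by
  ext v
  rw [Submodule.mem_span_singleton]
  constructor
  · rintro ⟨h0, h⟩
    refine ⟨v.2 (Fin.last N), ?_⟩
    ext i
    · simp [h0]
    · induction i using Fin.lastCases with
      | last => simp
      | cast i =>
        have : v.2 i.castSucc = 0 := h _ (by rw [Fin.val_castSucc]; omega)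
        simp [this]
  · rintro ⟨a, rfl⟩
    refine ⟨by simp, fun j hj => ?_⟩
    have : j ≠ Fin.last N := fun h => by rw [h, Fin.val_last] at hj; omega
    simp [this]

/-- Self-duality of the linearization curve from an alternating form for which it is orthogonal
to the linearization of the contact hyperplanes. -/
theorem IsSolution.isSelfDual_of_bilinForm {n : ℕ} (hn : N + 1 = 2 * n)
    (hy : E.IsSolution I y) (hU : IsOpen U) (hUE : U ⊆ E.domain) (hπ : ContDiffOn ℝ ∞ π U)
    (hker : ∀ p ∈ U, LinearMap.ker (fderiv ℝ π p : Jet N →ₗ[ℝ] (Fin (N + 1) → ℝ)) =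
      Submodule.span ℝ {E.field p}) (hyU : ∀ x ∈ I, Jet.ofFun N y x ∈ U)
    {γ : ℝ → Submodule ℝ (Fin (N + 1) → ℝ)}
    (hγ : ∀ x ∈ I, γ x = (vertical N 1).map
      (fderiv ℝ π (Jet.ofFun N y x) : Jet N →ₗ[ℝ] (Fin (N + 1) → ℝ)))
    {B : LinearMap.BilinForm ℝ (Fin (N + 1) → ℝ)} (hBa : B.IsAlt)
    (hne : ∀ x ∈ I, ∃ w, B (fderiv ℝ π (Jet.ofFun N y x) (0, Pi.single (Fin.last N) 1)) w ≠ 0)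
    (hB : ∀ x ∈ I, ∀ v : Fin (N + 1) → ℝ, v 0 = 0 →
      B (fderiv ℝ π (Jet.ofFun N y x) (0, Pi.single (Fin.last N) 1))
        (fderiv ℝ π (Jet.ofFun N y x) (0, v)) = 0) :
    ProjCurve.IsSelfDual γ I ∧ ProjCurve.HasLagrangianOsculating γ I := by
  set e : ℝ → (Fin (N + 1) → ℝ) := fun x =>
    fderiv ℝ π (Jet.ofFun N y x) (0, Pi.single (Fin.last N) 1) with he
  have hit := hy.iteratedDeriv_fderiv hU hUE hπ (fun p hp => fderiv_field_eq_zero hker hp) hyU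
  have hfr : ∀ x ∈ I, ∀ j, E.frame y j x = (0, (E.frame y j x).2) := fun x hx j =>
    Prod.ext (hy.frame_fst j x hx) rfl
  refine ProjCurve.isSelfDual_and_hasLagrangianOsculating (e := e) hn hy.isOpen hy.nonempty
    ⟨?_, ?_, ?_⟩ ?_ hBa ?_ hne
  · exact ((hπ.fderiv_of_isOpen hU (m := ∞) (by simp)).comp (hy.contDiffOn_ofFun N) hyU).clm_apply
      contDiffOn_const
  · intro x hx h0
    have := congr_fun (eq_zero_of_fderiv_vertical hker (hyU x hx) h0) (Fin.last N)
    simp at this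
  · intro x hx
    rw [hγ x hx, vertical_one, Submodule.map_span, Set.image_singleton]
    rfl
  · intro x hx
    have h := (hy.linearIndependent_frame hx).map'
      ((fderiv ℝ π (Jet.ofFun N y x)).comp
        (ContinuousLinearMap.inr ℝ ℝ (Fin (N + 1) → ℝ))).toLinearMap
      (LinearMap.ker_eq_bot'.2 fun v hv => eq_zero_of_fderiv_vertical hker (hyU x hx) hv)
    convert! h using 2 with j
    rw [hit j x hx, hfr x hx]
    rfl
  · intro x hx j hj
    rw [hit j x hx, hfr x hx]
    refine hB x hx _ ?_
    -- The ∂/∂y_0 entry of the frame first becomes nonzero at j = N.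
    rw [hy.frame_snd_aux j hj.le 0 (by simpa using hj.le) x hx, if_neg]
    rw [Fin.val_zero]
    omega

/-- The form is taken from the target equation, using π composed with the inverse transformation as
first-integral map there; both equations thus share one model of the tangent space of `Sol`, and `B`
needs no change. N ≥ 2 ensures that the transformation of J^N covers one of J^{N-1}, hence preserves
the line of ∂/∂y_N; a contact transformation of J^1 need not do so. -/
theorem exists_bilinForm_of_contactEquivalent (hE' : E'.IsEulerLagrange)
    (hEE' : ContactEquivalent E E') (hN : 2 ≤ N)
    (hy : E.IsSolution I y) (hU : IsOpen U) (hUE : U ⊆ E.domain) (hπ : ContDiffOn ℝ ∞ π U)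
    (hker : ∀ p ∈ U, LinearMap.ker (fderiv ℝ π p : Jet N →ₗ[ℝ] (Fin (N + 1) → ℝ)) =
      Submodule.span ℝ {E.field p}) (hyU : ∀ x ∈ I, Jet.ofFun N y x ∈ U) :
    ∃ B : LinearMap.BilinForm ℝ (Fin (N + 1) → ℝ), B.IsAlt ∧
      (∀ x ∈ I, ∃ w, B (fderiv ℝ π (Jet.ofFun N y x) (0, Pi.single (Fin.last N) 1)) w ≠ 0) ∧
      ∀ x ∈ I, ∀ v : Fin (N + 1) → ℝ, v 0 = 0 →
        B (fderiv ℝ π (Jet.ofFun N y x) (0, Pi.single (Fin.last N) 1))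
          (fderiv ℝ π (Jet.ofFun N y x) (0, v)) = 0 := by
  obtain ⟨Φ, h1, hΦ, hsrc, himg⟩ := hEE'
  have hΨ := isContactTransformation_of_tower h1 hΦ (k := N) (by omega) (by omega)
  have hpro := hΦ N (by omega) le_rfl
  have hfield := fun p (hp : p ∈ E.domain) =>
    fderiv_field_of_isProlongation hΨ hpro hsrc himg hp
  obtain ⟨m, rfl⟩ : ∃ m, N = m + 1 := ⟨N - 1, by omega⟩
  set Ψ := Φ (m + 1) with hΨdef
  set π' : Jet (m + 1) → (Fin (m + 1 + 1) → ℝ) := π ∘ Ψ.symm with hπ'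
  set U' := Ψ.target ∩ Ψ.symm ⁻¹' U with hU'def
  have hU' : IsOpen U' := Ψ.symm.isOpen_inter_preimage hU
  have hpU' : ∀ p ∈ U, Ψ p ∈ U' := fun p hp =>
    ⟨Ψ.map_source (hfield p (hUE hp)).1, by
      rw [Set.mem_preimage, Ψ.left_inv (hfield p (hUE hp)).1]; exact hp⟩
  have hU'p : ∀ q ∈ U', ∃ p ∈ U, Ψ p = q := fun q hq => ⟨Ψ.symm q, hq.2, Ψ.right_inv hq.1⟩
  have hU'E : U' ⊆ E'.domain := by
    intro q hq
    obtain ⟨p, hp, rfl⟩ := hU'p q hq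
    exact (hfield p (hUE hp)).2.1
  have hπ's : ContDiffOn ℝ ∞ π' U' :=
    hπ.comp (hΨ.smooth_symm.mono Set.inter_subset_left) fun q hq => hq.2
  have hpush : ∀ p ∈ U, ∀ v, fderiv ℝ π' (Ψ p) (fderiv ℝ Ψ p v) = fderiv ℝ π p v := by
    intro p hp v
    have hps := (hfield p (hUE hp)).1
    have hd : HasFDerivAt π' (fderiv ℝ π' (Ψ p)) (Ψ p) :=
      ((hπ's.contDiffAt (hU'.mem_nhds (hpU' p hp))).differentiableAt (by simp)).hasFDerivAt
    have hd2 := (hd.comp p (hΨ.hasFDerivAt hps)).congr_of_eventuallyEq (f₁ := π) (by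
      filter_upwards [Ψ.eventually_left_inverse hps] with q hq
      simp [hπ', hq])
    rw [hd2.fderiv]
    rfl
  have hker' : ∀ q ∈ U', fderiv ℝ π' q (E'.field q) = 0 := by
    intro q hq
    obtain ⟨p, hp, rfl⟩ := hU'p q hq
    obtain ⟨-, -, hr, hf⟩ := hfield p (hUE hp)
    have h := hpush p hp (E.field p)
    rw [fderiv_field_eq_zero hker hp, hf, map_smul] at h
    exact (smul_eq_zero.1 h).resolve_left hr
  -- A vertical vector killed by dπ' is the image of a multiple of the field of `E`; that image has
  -- x-component a nonzero factor times the multiple, so the multiple is zero.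
  have hinj : ∀ p ∈ U, ∀ v : Fin (m + 1 + 1) → ℝ, fderiv ℝ π' (Ψ p) (0, v) = 0 → v = 0 := by
    intro p hp v hv
    obtain ⟨hps, -, hr, hf⟩ := hfield p (hUE hp)
    have hv2 := hΨ.fderiv_fderiv_symm hps (0, v)
    set u := fderiv ℝ Ψ.symm (Ψ p) (0, v)
    have hu : u ∈ Submodule.span ℝ {E.field p} := by
      rw [← hker p hp, LinearMap.mem_ker]
      exact (hpush p hp u).symm.trans (by rw [hv2]; exact hv)
    obtain ⟨a, ha⟩ := Submodule.mem_span_singleton.1 hu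
    rw [← ha, map_smul] at hv2
    have ha0 : a = 0 := by
      have := congrArg Prod.fst hv2
      simpa [hr] using this
    rw [ha0, zero_smul] at hv2
    exact (congrArg Prod.snd hv2).symm
  obtain ⟨B, hBa, hB⟩ := hE'.exists_bilinForm (I := I)
    (c := fun x => Ψ (Jet.ofFun (m + 1) y x))
    (r := fun x => (fderiv ℝ Ψ (Jet.ofFun (m + 1) y x) (E.field (Jet.ofFun (m + 1) y x))).1)
    hU' hU'E hπ's hker' hy.isOpen hy.ordConnected hy.nonempty
    (fun x hx => hpU' _ (hyU x hx))
    (fun x hx => by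
      have hp := hfield _ (hUE (hyU x hx))
      rw [← hp.2.2.2]
      exact (hΨ.hasFDerivAt hp.1).comp_hasDerivAt x (hy.hasDerivAt_ofFun hx))
    (fun x hx => hinj _ (hyU x hx))
  have htop : ∀ p ∈ U, ∃ a : ℝ, a ≠ 0 ∧ fderiv ℝ Ψ p (0, Pi.single (Fin.last (m + 1)) 1) =
      a • ((0, Pi.single (Fin.last (m + 1)) 1) : Jet (m + 1)) := by
    intro p hp
    have hps := (hfield p (hUE hp)).1
    have hprom := hΦ m (by omega) (by omega)
    have h := hprom.truncL_fderiv
      (isContactTransformation_of_tower h1 hΦ (by omega) (by omega)) hps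
      (0, Pi.single (Fin.last (m + 1)) 1)
    have h0 : truncL (Nat.le_succ m) ((0, Pi.single (Fin.last (m + 1)) 1) : Jet (m + 1)) = 0 := by
      ext i
      · rfl
      · exact Pi.single_eq_of_ne (M := fun _ : Fin (m + 1 + 1) => ℝ)
          (fun h => by have := congrArg Fin.val h; simp at this; omega) 1
    rw [h0, map_zero] at h
    have hmem : fderiv ℝ Ψ p (0, Pi.single (Fin.last (m + 1)) 1) ∈ vertical (m + 1) 1 :=
      ⟨congrArg Prod.fst h, fun j hj => congr_fun (congrArg Prod.snd h) ⟨j, by omega⟩⟩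
    rw [vertical_one] at hmem
    obtain ⟨a, ha⟩ := Submodule.mem_span_singleton.1 hmem
    refine ⟨a, fun ha0 => ?_, ha.symm⟩
    rw [ha0, zero_smul] at ha
    refine hΨ.fderiv_ne_zero hps (fun h => ?_) ha.symm
    have := congr_fun (congrArg Prod.snd h) (Fin.last (m + 1))
    simp at this
  refine ⟨B, hBa, fun x hx => ?_, fun x hx v hv => ?_⟩
  · have hp := hyU x hx
    obtain ⟨a, ha, hae⟩ := htop _ hp
    obtain ⟨b, hb, hbv⟩ := hB x hx
    -- The image of ∂/∂y_0 has v_0 = 1, so the pairing equals a * b.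
    refine ⟨fderiv ℝ π' (Ψ (Jet.ofFun (m + 1) y x)) (0, Pi.single 0 1), ?_⟩
    rw [← hpush _ hp, hae, map_smul, map_smul, LinearMap.smul_apply, hbv]
    simpa using ⟨ha, hb⟩
  · have hp := hyU x hx
    set p := Jet.ofFun (m + 1) y x
    obtain ⟨a, ha, hae⟩ := htop _ hp
    obtain ⟨b, hb, hbv⟩ := hB x hx
    have hps := (hfield p (hUE hp)).1
    have hcon := contact_form_of_tower h1 hΦ m (by omega) p hps (0, v) (by simpa using hv)
    set V := fderiv ℝ Ψ p (0, v) with hV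
    -- The image of a vertical vector need not be vertical, since x may change. Subtracting a
    -- multiple of the field, which dπ' kills, makes it vertical; preservation of dy_0 - y_1 dx says
    -- that its y_0 component is then zero.
    have hVd : V = V.1 • E'.field (Ψ p) + (0, V.2 - V.1 • (E'.field (Ψ p)).2) := by
      ext i <;> simp [field]
    have h0 : (V.2 - V.1 • (E'.field (Ψ p)).2) 0 = 0 := by
      have hf0 : (E'.field (Ψ p)).2 0 = (Ψ p).2 1 :=
        Fin.snoc_castSucc (α := fun _ => ℝ) (E'.F (Ψ p)) (fun j : Fin (m + 1) => (Ψ p).2 j.succ) 0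
      rw [Pi.sub_apply, Pi.smul_apply, hf0, smul_eq_mul, mul_comm]
      exact sub_eq_zero.2 hcon
    rw [← hpush p hp, ← hpush p hp, ← hV, hVd, map_add, map_smul, hker' _ (hpU' p hp), smul_zero,
      zero_add, hae, map_smul, map_smul, LinearMap.smul_apply, hbv, h0, mul_zero, smul_zero]

/-- For equations of order two any area form has the required property. -/
theorem exists_bilinForm_of_order_two {E : ScalarODE 1} {π : Jet 1 → (Fin 2 → ℝ)} {U : Set (Jet 1)}
    (hker : ∀ p ∈ U, LinearMap.ker (fderiv ℝ π p : Jet 1 →ₗ[ℝ] (Fin 2 → ℝ)) =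
      Submodule.span ℝ {E.field p}) (hyU : ∀ x ∈ I, Jet.ofFun 1 y x ∈ U) :
    ∃ B : LinearMap.BilinForm ℝ (Fin 2 → ℝ), B.IsAlt ∧
      (∀ x ∈ I, ∃ w, B (fderiv ℝ π (Jet.ofFun 1 y x) (0, Pi.single (Fin.last 1) 1)) w ≠ 0) ∧
      ∀ x ∈ I, ∀ v : Fin 2 → ℝ, v 0 = 0 →
        B (fderiv ℝ π (Jet.ofFun 1 y x) (0, Pi.single (Fin.last 1) 1))
          (fderiv ℝ π (Jet.ofFun 1 y x) (0, v)) = 0 := by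
  let B : LinearMap.BilinForm ℝ (Fin 2 → ℝ) :=
    LinearMap.BilinForm.linMulLin (LinearMap.proj 0) (LinearMap.proj 1) -
      LinearMap.BilinForm.linMulLin (LinearMap.proj 1) (LinearMap.proj 0)
  have hBv : ∀ v w, B v w = v 0 * w 1 - v 1 * w 0 := fun v w => by simp [B]
  have hBa : B.IsAlt := fun v => by rw [hBv]; ring
  refine ⟨B, hBa, fun x hx => ?_, fun x hx v hv => ?_⟩
  · by_contra! h
    have h0 := h (Pi.single 0 1)
    have h1 := h (Pi.single 1 1)
    rw [hBv] at h0 h1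
    have hz : fderiv ℝ π (Jet.ofFun 1 y x) (0, Pi.single (Fin.last 1) 1) = 0 := by
      ext i
      fin_cases i
      · simpa using h1
      · simpa using h0
    have := congr_fun (eq_zero_of_fderiv_vertical hker (hyU x hx) hz) (Fin.last 1)
    simp at this
  · have hvs : ((0, v) : Jet 1) = v 1 • ((0, Pi.single (Fin.last 1) 1) : Jet 1) := by
      ext i
      · simp
      · fin_cases i
        · simp [hv]
        · simp
    rw [hvs, map_smul, map_smul, hBa, smul_zero]

end ScalarODE

end

/-! ### The theorem, in a chart of the solution space -/

theorem mainTheorem8 {N : ℕ} (E : ScalarODE N) (hE : E.IsVariational)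
    (Γ : E.Sol) (I : Set ℝ) (y : ℝ → ℝ) (hy : E.IsSolution I y)
    (hΓ : ∀ (x : ℝ) (hx : x ∈ I), E.toSol ⟨Jet.ofFun N y x, hy.mem_domain x hx⟩ = Γ)
    (κ : OpenPartialHomeomorph E.Sol (Fin (N + 1) → ℝ)) (hκ : E.IsSmoothChart κ)
    (hκΓ : Γ ∈ κ.source) :
    ProjCurve.IsSelfDual (E.lin κ 1 y) I ∧
      ProjCurve.HasLagrangianOsculating (E.lin κ 1 y) I := by
  obtain ⟨E', hE', hEE'⟩ := hE
  obtain ⟨n, hn⟩ : ∃ n, N + 1 = 2 * n := by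
    obtain ⟨n, hn, -⟩ := hE'
    exact ⟨n, hn⟩
  set U : Set (Jet N) := Subtype.val '' (E.toSol ⁻¹' κ.source) with hUdef
  have hU : IsOpen U :=
    E.isOpen_domain.isOpenMap_subtype_val _ (κ.open_source.preimage continuous_quot_mk)
  have hUE : U ⊆ E.domain := by
    rintro _ ⟨p, -, rfl⟩
    exact p.2
  have hπ : ContDiffOn ℝ ∞ (E.projIn κ) U := by
    rintro _ ⟨p, hp, rfl⟩
    exact (hκ p hp).1.contDiffWithinAt
  have hker : ∀ p ∈ U, LinearMap.ker (fderiv ℝ (E.projIn κ) p : Jet N →ₗ[ℝ] (Fin (N + 1) → ℝ)) =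
      Submodule.span ℝ {E.field p} := by
    rintro _ ⟨p, hp, rfl⟩
    exact (hκ p hp).2
  have hyU : ∀ x ∈ I, Jet.ofFun N y x ∈ U := fun x hx =>
    ⟨⟨_, hy.mem_domain x hx⟩, by rw [Set.mem_preimage, hΓ x hx]; exact hκΓ, rfl⟩
  have hB : ∃ B : LinearMap.BilinForm ℝ (Fin (N + 1) → ℝ), B.IsAlt ∧
      (∀ x ∈ I, ∃ w, B (fderiv ℝ (E.projIn κ) (Jet.ofFun N y x)
        (0, Pi.single (Fin.last N) 1)) w ≠ 0) ∧
      ∀ x ∈ I, ∀ v : Fin (N + 1) → ℝ, v 0 = 0 →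
        B (fderiv ℝ (E.projIn κ) (Jet.ofFun N y x) (0, Pi.single (Fin.last N) 1))
          (fderiv ℝ (E.projIn κ) (Jet.ofFun N y x) (0, v)) = 0 := by
    -- N + 1 is even, so N < 2 means N = 1.
    rcases Nat.lt_or_ge N 2 with hN | hN
    · obtain rfl : N = 1 := by omega
      exact ScalarODE.exists_bilinForm_of_order_two hker hyU
    · exact ScalarODE.exists_bilinForm_of_contactEquivalent hE' hEE' hN hy hU hUE hπ hker hyU
  obtain ⟨B, hBa, hne, hB0⟩ := hB
  exact hy.isSelfDual_of_bilinForm hn hU hUE hπ hker hyU (fun x _ => rfl) hBa hne hB0
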